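/- **Notation.** Let $n\ge 1$, $\gamma>0$, and let $\mathcal E,\mathcal H$ be complex Hilbert spaces. Tensor products of Hilbert spaces are completed, and $B(\mathcal E)\otimes_{min}B(\mathcal H)$ is the norm closure in $B(\mathcal E\otimes\mathcal H)$ of the span of the operators $Y\otimes T$. For $\rho>0$ let $$[B(\mathcal H)^n]_\rho=\Big\{(X_1,\dots,X_n)\in B(\mathcal H)^n:\ \Big\|\sum_i X_iX_i^*\Big\|^{1/2}<\rho\Big\}.$$ $\mathbb F_n^+$ is the free monoid on $g_1,\dots,g_n$; for $\alpha=g_{i_1}\cdots g_{i_k}$ put $|\alpha|=k$ and $X_\alpha=X_{i_1}\cdots X_{i_k}$. $F^2(H_n)$ is the full Fock space of $\mathbb C^n$, with orthonormal basis $(e_\alpha)_{\alpha\in\mathbb F_n^+}$ and vacuum vector $1=e_{g_0}$, where $g_0$ is the identity of $\mathbb F_n^+$; $S_i e_\alpha=e_{g_i\alpha}$ and $R_ie_\alpha=e_{\alpha g_i}$ are the left and right creation operators, and $S=(S_1,\dots,S_n)$. $\mathcal P_n$ is the algebra of polynomials in $S_1,\dots,S_n,I$, and $\mathcal P_n(\mathcal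 E)=B(\mathcal E)\otimes\mathcal P_n\subset B(\mathcal E\otimes F^2(H_n))$. A map $F:[B(\mathcal H)^n]_\gamma\to B(\mathcal E)\otimes_{min}B(\mathcal H)$ is *free holomorphic* with coefficients $A_{(\alpha)}\in B(\mathcal E)$ ($\alpha\in\mathbb F_n^+$) if $\limsup_k\|\sum_{|\alpha|=k}A_{(\alpha)}^*A_{(\alpha)}\|^{1/2k}\le 1/\gamma$ and $F(X)=\sum_{k=0}^\infty\sum_{|\alpha|=k}A_{(\alpha)}\otimes X_\alpha$ in norm for all $X\in[B(\mathcal H)^n]_\gamma$. A map $u$ is *free pluriharmonic* on $[B(\mathcal H)^n]_\gamma$ if $u=\operatorname{Re}F_1+i\operatorname{Re}F_2$ with $F_1,F_2$ free holomorphic. Its *representation* on another Hilbert space $\mathcal K$ is the function on $[B(\mathcal K)^n]_\gamma$ given by the same formula with the same coefficients of $F_1,F_2$; $u(rS)$ denotes the value at $rS=(rS_1,\dots,rS_n)$ of its representation on $F^2(H_n)$. (If $\mathcal H$ is finite dimensional, the coefficients are regarded as part of $u$.) For $X\in[B(\mathcal H)^n]_1$ the *Poisson kernel* $K_X:\mathcal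 H\to F^2(H_n)\otimes\mathcal H$ is $$K_Xh=\big(I\otimes\Delta_X\big)\Big(I-\sum_i R_i\otimes X_i^*\Big)^{-1}(1\otimes h),\qquad \Delta_X=\Big(I-\sum_iX_iX_i^*\Big)^{1/2},$$ and for $f\in B(\mathcal E\otimes F^2(H_n))$ the *Poisson transform* is $${\bf P}_X[f]=(I_{\mathcal E}\otimes K_X^*)(f\otimes I_{\mathcal H})(I_{\mathcal E}\otimes K_X)\in B(\mathcal E\otimes\mathcal H).$$ **Theorem.** (a) If $u:[B(\mathcal H)^n]_\gamma\to B(\mathcal E)\otimes_{min}B(\mathcal H)$ is free pluriharmonic, then it has a representation on $F^2(H_n)$, and 1. $u(rS)\in\overline{\mathcal P_n(\mathcal E)^*+\mathcal P_n(\mathcal E)}^{\|\cdot\|}$ for all $r\in[0,\gamma)$; 2. $u(X)={\bf P}_{\frac1rX}[u(rS)]$ for all $r\in(0,\gamma)$ and $X\in[B(\mathcal H)^n]_r$. (b) Conversely, let $\varphi:[0,\gamma)\to\overline{\mathcal P_n(\mathcal E)^*+\mathcal P_n(\mathcal E)}^{\|\cdot\|}$ satisfy $\varphi(r)={\bf P}_{\frac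 rtS}[\varphi(t)]$ for $0\le r<t<\gamma$. Then $$v(X):={\bf P}_{\frac1rX}[\varphi(r)],\qquad X\in[B(\mathcal H)^n]_r,\ r\in(0,\gamma),$$ is well defined (independent of $r$) and is a free pluriharmonic function $v:[B(\mathcal H)^n]_\gamma\to B(\mathcal E)\otimes_{min}B(\mathcal H)$. Moreover, the map given by the same formula on $[B(F^2(H_n))^n]_\gamma$ is a representation of $v$ on $F^2(H_n)$, and with it $v(rS)=\varphi(r)$ for all $r\in[0,\gamma)$. -/

import Mathlib

open scoped TensorProduct InnerProductSpace ENNReal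
open Filter Topology

noncomputable section

namespace FreePluri

universe u v w

/-! ### Hilbert space tensor products -/

/-- The algebra `B(H)` of bounded linear operators on `H`. -/
abbrev Op (H : Type u) [NormedAddCommGroup H] [InnerProductSpace ℂ H] : Type u := H →L[ℂ] H

/-- The Hilbert space tensor product of `E` and `F`: the completion of the algebraic tensor
product for the inner product `⟪x ⊗ y, x' ⊗ y'⟫ = ⟪x, x'⟫ ⟪y, y'⟫`. -/
abbrev HTensor (E : Type u) (F : Type v) [NormedAddCommGroup E] [InnerProductSpace ℂ E]
    [NormedAddCommGroup F] [InnerProductSpace ℂ F] : Type (max u v) :=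
  UniformSpace.Completion (E ⊗[ℂ] F)

section Tensor

variable {E : Type*} {F : Type*} {G : Type*} {E' : Type*} {F' : Type*}
  [NormedAddCommGroup E] [InnerProductSpace ℂ E] [NormedAddCommGroup F] [InnerProductSpace ℂ F]
  [NormedAddCommGroup G] [InnerProductSpace ℂ G]
  [NormedAddCommGroup E'] [InnerProductSpace ℂ E'] [NormedAddCommGroup F'] [InnerProductSpace ℂ F']

/-- The elementary tensor `x ⊗ y`, as a vector of the Hilbert space tensor product. -/
def tmul (x : E) (y : F) : HTensor E F := ((x ⊗ₜ[ℂ] y : E ⊗[ℂ] F) : HTensor E F)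

/-- The tensor product `A ⊗ B` of two bounded operators, `(A ⊗ B) (x ⊗ y) = A x ⊗ B y`. -/
def opTensor (A : E →L[ℂ] E') (B : F →L[ℂ] F') : HTensor E F →L[ℂ] HTensor E' F' :=
  (TensorProduct.mapL A B).completion

theorem opTensor_tmul (A : E →L[ℂ] E') (B : F →L[ℂ] F') (x : E) (y : F) :
    opTensor A B (tmul x y) = tmul (A x) (B y) := by
  simp [opTensor, tmul]

/-- The bounded operator `y ↦ x ⊗ y`. -/
def tmulLeft (F : Type*) [NormedAddCommGroup F] [InnerProductSpace ℂ F] (x : E) :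
    F →L[ℂ] HTensor E F :=
  UniformSpace.Completion.toComplL ∘L TensorProduct.mkL ℂ E F x

theorem tmulLeft_apply (x : E) (y : F) : tmulLeft F x y = tmul x y := rfl

theorem inner_tmul (x x' : E) (y y' : F) :
    ⟪tmul x y, tmul x' y'⟫_ℂ = ⟪x, x'⟫_ℂ * ⟪y, y'⟫_ℂ := by
  simp [tmul]

theorem tensor_induction {p : HTensor E F → Prop} (z : HTensor E F) (hc : IsClosed {z | p z})
    (h0 : p 0) (ht : ∀ x y, p (tmul x y)) (ha : ∀ z z', p z → p z' → p (z + z')) : p z := by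
  refine UniformSpace.Completion.induction_on z hc fun a => ?_
  induction a with
  | zero => rw [UniformSpace.Completion.coe_zero]; exact h0
  | tmul x y => exact ht x y
  | add a b hha hhb => simpa [UniformSpace.Completion.coe_add] using ha _ _ hha hhb

theorem tmulLeft_add (x x' : E) : tmulLeft F (x + x') = tmulLeft F x + tmulLeft F x' := by
  ext y
  simp [tmulLeft]

theorem tmulLeft_smul (c : ℂ) (x : E) : tmulLeft F (c • x) = c • tmulLeft F x := by
  ext y
  simp [tmulLeft]

/-- The linear map `x ⊗ ζ ↦ (x ⊗ id) ζ` behind the associativity isomorphism. -/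
def assocAux (E F G : Type*) [NormedAddCommGroup E] [InnerProductSpace ℂ E]
    [NormedAddCommGroup F] [InnerProductSpace ℂ F] [NormedAddCommGroup G] [InnerProductSpace ℂ G] :
    E ⊗[ℂ] HTensor F G →ₗ[ℂ] HTensor (HTensor E F) G :=
  TensorProduct.lift <| LinearMap.mk₂ ℂ
    (fun (x : E) (ζ : HTensor F G) => opTensor (tmulLeft F x) (ContinuousLinearMap.id ℂ G) ζ)
    (by
      intro x x' ζ
      refine tensor_induction (p := fun ζ : HTensor F G =>
        opTensor (tmulLeft F (x + x')) (ContinuousLinearMap.id ℂ G) ζ =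
          opTensor (tmulLeft F x) (ContinuousLinearMap.id ℂ G) ζ +
            opTensor (tmulLeft F x') (ContinuousLinearMap.id ℂ G) ζ) ζ
        (isClosed_eq (by fun_prop) (by fun_prop)) (by simp) ?_ ?_
      · intro y z
        simp only [opTensor_tmul, tmulLeft_add, add_apply]
        rw [← tmulLeft_apply, tmulLeft_add]
        rfl
      · intro z z' hz hz'
        rw [map_add, map_add, map_add, hz, hz']
        abel)
    (by
      intro c x ζ
      refine tensor_induction (p := fun ζ : HTensor F G =>
        opTensor (tmulLeft F (c • x)) (ContinuousLinearMap.id ℂ G) ζ =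
          c • opTensor (tmulLeft F x) (ContinuousLinearMap.id ℂ G) ζ) ζ
        (isClosed_eq (ContinuousLinearMap.continuous _)
          ((ContinuousLinearMap.continuous _).const_smul c))
        (by rw [map_zero, map_zero, smul_zero]) ?_ ?_
      · intro y z
        rw [opTensor_tmul, opTensor_tmul, ← tmulLeft_apply, ← tmulLeft_apply, tmulLeft_smul]
        exact DFunLike.congr_fun (tmulLeft_smul (F := G) c (tmulLeft F x y)) z
      · intro z z' hz hz'
        rw [map_add, map_add, smul_add, hz, hz'])
    (by intro x ζ ζ'; exact map_add _ _ _)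
    (by intro c x ζ; exact map_smul _ _ _)

theorem assocAux_tmul (x : E) (ζ : HTensor F G) :
    assocAux E F G (x ⊗ₜ ζ) = opTensor (tmulLeft F x) (ContinuousLinearMap.id ℂ G) ζ := rfl

theorem assocAux_inner (a b : E ⊗[ℂ] HTensor F G) :
    ⟪assocAux E F G a, assocAux E F G b⟫_ℂ = ⟪a, b⟫_ℂ := by
  induction a with
  | zero => rw [map_zero, inner_zero_left]; exact (inner_zero_left (𝕜 := ℂ) b).symm
  | add a a' ha ha' =>
    rw [map_add, inner_add_left, ha, ha']
    exact (inner_add_left (𝕜 := ℂ) a a' b).symm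
  | tmul x ζ =>
    induction b with
    | zero => rw [map_zero, inner_zero_right]; exact (inner_zero_right (𝕜 := ℂ) (x ⊗ₜ[ℂ] ζ)).symm
    | add b b' hb hb' =>
      rw [map_add, inner_add_right, hb, hb']
      exact (inner_add_right (𝕜 := ℂ) (x ⊗ₜ[ℂ] ζ) b b').symm
    | tmul x' ζ' =>
      rw [assocAux_tmul, assocAux_tmul, TensorProduct.inner_tmul]
      refine tensor_induction (p := fun ζ : HTensor F G =>
        ⟪opTensor (tmulLeft F x) (ContinuousLinearMap.id ℂ G) ζ,
          opTensor (tmulLeft F x') (ContinuousLinearMap.id ℂ G) ζ'⟫_ℂ = ⟪x, x'⟫_ℂ * ⟪ζ, ζ'⟫_ℂ)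
        ζ (isClosed_eq (by fun_prop) (by fun_prop)) (by simp) ?_ ?_
      · intro y z
        refine tensor_induction (p := fun ζ' : HTensor F G =>
          ⟪opTensor (tmulLeft F x) (ContinuousLinearMap.id ℂ G) (tmul y z),
            opTensor (tmulLeft F x') (ContinuousLinearMap.id ℂ G) ζ'⟫_ℂ =
              ⟪x, x'⟫_ℂ * ⟪tmul y z, ζ'⟫_ℂ)
          ζ' (isClosed_eq (by fun_prop) (by fun_prop)) (by simp) ?_ ?_
        · intro y' z'
          simp only [opTensor_tmul, tmulLeft_apply, inner_tmul, ContinuousLinearMap.id_apply]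
          ring
        · intro z z' hz hz'
          rw [map_add, inner_add_right, inner_add_right, hz, hz']
          ring
      · intro z z' hz hz'
        rw [map_add, inner_add_left, inner_add_left, hz, hz']
        ring

/-- The canonical identification `E ⊗ (F ⊗ G) = (E ⊗ F) ⊗ G` of Hilbert space tensor products. -/
def assoc (E F G : Type*) [NormedAddCommGroup E] [InnerProductSpace ℂ E]
    [NormedAddCommGroup F] [InnerProductSpace ℂ F] [NormedAddCommGroup G] [InnerProductSpace ℂ G] :
    HTensor E (HTensor F G) →L[ℂ] HTensor (HTensor E F) G :=
  ((assocAux E F G).isometryOfInner assocAux_inner).toContinuousLinearMap.fromCompletion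

theorem assoc_tmul (x : E) (y : F) (z : G) :
    assoc E F G (tmul x (tmul y z)) = tmul (tmul x y) z := by
  have : assoc E F G (tmul x (tmul y z)) = assocAux E F G (x ⊗ₜ tmul y z) := by
    rw [assoc, tmul, ContinuousLinearMap.fromCompletion_apply_coe]
    rfl
  rw [this, assocAux_tmul, opTensor_tmul, tmulLeft_apply]
  rfl

/-- The spatial (minimal) tensor product `B(E) ⊗_min B(H)`: the norm closure in `B(E ⊗ H)` of the
linear span of the elementary tensors `Y ⊗ T`. -/
def minTensor (E H : Type*) [NormedAddCommGroup E] [InnerProductSpace ℂ E]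
    [NormedAddCommGroup H] [InnerProductSpace ℂ H] : Set (Op (HTensor E H)) :=
  closure (Submodule.span ℂ {T | ∃ (Y : Op E) (Z : Op H), T = opTensor Y Z} :
    Set (Op (HTensor E H)))

end Tensor

/-! ### The full Fock space and the creation operators -/

/-- The full Fock space `F²(H_n)` on `n` generators, written in its orthonormal basis
`(e_α)` indexed by the free monoid on `n` generators. -/
abbrev Fock (n : ℕ) : Type := lp (fun _ : FreeMonoid (Fin n) => ℂ) 2

open Classical in
/-- The basis vector `e_α = e_{i₁} ⊗ ⋯ ⊗ e_{i_k}` for `α = g_{i₁} ⋯ g_{i_k}`. -/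
def fockBasis {n : ℕ} (α : FreeMonoid (Fin n)) : Fock n := lp.single 2 α 1

open Classical in
theorem orthonormal_fockBasis (n : ℕ) : Orthonormal ℂ (fockBasis (n := n)) := by
  rw [orthonormal_iff_ite]
  intro α β
  rw [fockBasis, fockBasis, lp.inner_single_left, lp.single_apply]
  by_cases h : α = β
  · subst h; simp
  · rw [if_neg h, Pi.single_eq_of_ne h]; simp

/-- The isometry `e_α ↦ e_{f α}` of the Fock space given by an injective map `f` of words. -/
def wordIsometry {n : ℕ} (f : FreeMonoid (Fin n) → FreeMonoid (Fin n))
    (hf : Function.Injective f) : Fock n →ₗᵢ[ℂ] Fock n :=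
  ((orthonormal_fockBasis n).comp f hf).orthogonalFamily.linearIsometry

open Classical in
theorem wordIsometry_fockBasis {n : ℕ} (f : FreeMonoid (Fin n) → FreeMonoid (Fin n))
    (hf : Function.Injective f) (α : FreeMonoid (Fin n)) :
    wordIsometry f hf (fockBasis α) = fockBasis (f α) := by
  rw [wordIsometry, fockBasis, OrthogonalFamily.linearIsometry_apply_single]
  simp

/-- The left creation operator `S_i φ = e_i ⊗ φ`. -/
def leftCreation {n : ℕ} (i : Fin n) : Op (Fock n) :=
  (wordIsometry (fun α => FreeMonoid.of i * α)
    (mul_right_injective _)).toContinuousLinearMap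

/-- The right creation operator `R_i φ = φ ⊗ e_i`. -/
def rightCreation {n : ℕ} (i : Fin n) : Op (Fock n) :=
  (wordIsometry (fun α => α * FreeMonoid.of i)
    (mul_left_injective _)).toContinuousLinearMap

theorem leftCreation_fockBasis {n : ℕ} (i : Fin n) (α : FreeMonoid (Fin n)) :
    leftCreation i (fockBasis α) = fockBasis (FreeMonoid.of i * α) :=
  wordIsometry_fockBasis _ (mul_right_injective _) α

theorem rightCreation_fockBasis {n : ℕ} (i : Fin n) (α : FreeMonoid (Fin n)) :
    rightCreation i (fockBasis α) = fockBasis (α * FreeMonoid.of i) :=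
  wordIsometry_fockBasis _ (mul_left_injective _) α

/-- The set `𝒫_n` of all polynomials in `S_1, …, S_n` and the identity. -/
def polys (n : ℕ) : Subalgebra ℂ (Op (Fock n)) :=
  Algebra.adjoin ℂ (Set.range (leftCreation (n := n)))

/-! ### Noncommutative balls and the Poisson transform -/

section Ball

variable {n : ℕ} {E : Type u} {H : Type v} {K : Type w}
  [NormedAddCommGroup E] [InnerProductSpace ℂ E] [CompleteSpace E]
  [NormedAddCommGroup H] [InnerProductSpace ℂ H] [CompleteSpace H]
  [NormedAddCommGroup K] [InnerProductSpace ℂ K] [CompleteSpace K]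

/-- The algebraic tensor product `𝒫_n(E) = B(E) ⊗ 𝒫_n`, inside `B(E ⊗ F²(H_n))`. -/
def polysE (n : ℕ) (E : Type u) [NormedAddCommGroup E] [InnerProductSpace ℂ E] :
    Submodule ℂ (Op (HTensor E (Fock n))) :=
  Submodule.span ℂ {T | ∃ (Y : Op E) (p : Op (Fock n)), p ∈ polys n ∧ T = opTensor Y p}

/-- The norm closure of `𝒫_n(E)^* + 𝒫_n(E)`. -/
def harmonicSpace (n : ℕ) (E : Type u) [NormedAddCommGroup E] [InnerProductSpace ℂ E] :
    Set (Op (HTensor E (Fock n))) :=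
  closure {T | ∃ p ∈ polysE n E, ∃ q ∈ polysE n E, T = star p + q}

/-- The open noncommutative ball `[B(H)^n]_γ = {X : ‖∑ X_i X_i^*‖^{1/2} < γ}`. -/
def ncBall (H : Type v) [NormedAddCommGroup H] [InnerProductSpace ℂ H] [CompleteSpace H]
    (n : ℕ) (γ : ℝ) : Set (Fin n → Op H) :=
  {X | Real.sqrt ‖∑ i, X i * star (X i)‖ < γ}

/-- The defect operator `Δ_X = (I - ∑ X_i X_i^*)^{1/2}`. -/
def defect (X : Fin n → Op H) : Op H := CFC.sqrt (1 - ∑ i, X i * star (X i))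

/-- The reconstruction operator `R_X = ∑ R_i ⊗ X_i^*`. -/
def reconstruction (X : Fin n → Op H) : Op (HTensor (Fock n) H) :=
  ∑ i, opTensor (rightCreation i) (star (X i))

/-- The operator `B_X = (I ⊗ Δ_X) (I - R_X)⁻¹`. -/
def berezinKernel (X : Fin n → Op H) : Op (HTensor (Fock n) H) :=
  opTensor (1 : Op (Fock n)) (defect X) * Ring.inverse (1 - reconstruction X)

/-- The Poisson kernel `K_X = B_X |_{1 ⊗ H} : H → F²(H_n) ⊗ H`. -/
def poissonKernel (X : Fin n → Op H) : H →L[ℂ] HTensor (Fock n) H :=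
  berezinKernel X ∘L tmulLeft H (fockBasis (1 : FreeMonoid (Fin n)))

/-- The operator `I_E ⊗ K_X : E ⊗ H → E ⊗ F²(H_n) ⊗ H`. -/
def poissonKernelE (E : Type u) [NormedAddCommGroup E] [InnerProductSpace ℂ E]
    (X : Fin n → Op H) : HTensor E H →L[ℂ] HTensor (HTensor E (Fock n)) H :=
  assoc E (Fock n) H ∘L opTensor (1 : Op E) (poissonKernel X)

/-- The operator-valued Poisson transform `𝐏_X[f] = (I_E ⊗ K_X^*) (f ⊗ I_H) (I_E ⊗ K_X)`. -/
def poisson (X : Fin n → Op H) (f : Op (HTensor E (Fock n))) : Op (HTensor E H) :=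
  (poissonKernelE E X).adjoint ∘L opTensor f (1 : Op H) ∘L poissonKernelE E X

/-! ### Free holomorphic and free pluriharmonic functions -/

/-- The word `g_{i₁} ⋯ g_{i_k}`; as `w` varies these are all words of length `k`. -/
def word {k : ℕ} (w : Fin k → Fin n) : FreeMonoid (Fin n) := FreeMonoid.ofList (List.ofFn w)

/-- `X_α = X_{i₁} ⋯ X_{i_k}` for `α = g_{i₁} ⋯ g_{i_k}`. -/
def wordProd (X : Fin n → Op H) (α : FreeMonoid (Fin n)) : Op H := FreeMonoid.lift X α

/-- The radius of convergence `R` of `∑ A_(α) ⊗ Z_α`, where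
`1 / R = limsup_k ‖∑_{|α| = k} A_(α)^* A_(α)‖^{1 / (2k)}`. -/
def radius (A : FreeMonoid (Fin n) → Op E) : ℝ≥0∞ :=
  (limsup (fun k : ℕ => ‖∑ w : Fin k → Fin n, star (A (word w)) * A (word w)‖ₑ ^
    (1 / (2 * (k : ℝ)))) atTop)⁻¹

/-- `F` is (on the ball of radius `γ`) the free holomorphic function
`F(X) = ∑_k ∑_{|α| = k} A_(α) ⊗ X_α` with coefficients `A`. -/
structure HasHolomorphicExpansion (γ : ℝ) (A : FreeMonoid (Fin n) → Op E)
    (F : (Fin n → Op H) → Op (HTensor E H)) : Prop where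
  mem_minTensor : ∀ X ∈ ncBall H n γ, F X ∈ minTensor E H
  le_radius : ENNReal.ofReal γ ≤ radius A
  tendsto : ∀ X ∈ ncBall H n γ, Tendsto
    (fun m : ℕ => ∑ k ∈ Finset.range m, ∑ w : Fin k → Fin n,
      opTensor (A (word w)) (wordProd X (word w))) atTop (𝓝 (F X))

/-- The real part `Re T = (T + T^*) / 2`. -/
def rePart (T : Op (HTensor E H)) : Op (HTensor E H) := (1 / 2 : ℂ) • (T + star T)

/-- `G = Re F₁ + i Re F₂` on the ball of radius `γ`, where `F₁`, `F₂` are the free holomorphic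
functions with coefficients `A₁`, `A₂`. -/
def HasPluriharmonicExpansion (γ : ℝ) (A₁ A₂ : FreeMonoid (Fin n) → Op E)
    (G : (Fin n → Op H) → Op (HTensor E H)) : Prop :=
  (∀ X ∈ ncBall H n γ, G X ∈ minTensor E H) ∧
  ∃ F₁ F₂ : (Fin n → Op H) → Op (HTensor E H),
    HasHolomorphicExpansion γ A₁ F₁ ∧ HasHolomorphicExpansion γ A₂ F₂ ∧
    ∀ X ∈ ncBall H n γ, G X = rePart (F₁ X) + Complex.I • rePart (F₂ X)

/-- `G` is a free pluriharmonic function on `[B(H)^n]_γ` with coefficients in `B(E)`. Only the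
values of `G` on the ball matter. -/
def IsFreePluriharmonic (γ : ℝ) (G : (Fin n → Op H) → Op (HTensor E H)) : Prop :=
  ∃ A₁ A₂ : FreeMonoid (Fin n) → Op E, HasPluriharmonicExpansion γ A₁ A₂ G

/-- `G` and `G'` are the representations, on `H` and on `K`, of one and the same free
pluriharmonic function: they have the same coefficients. With `K = F²(H_n)`, this gives a meaning
to `G(rS_1, …, rS_n) = G'(rS_1, …, rS_n)` for a function `G` on `[B(H)^n]_γ`. -/
def SameFreePluriharmonic (γ : ℝ) (G : (Fin n → Op H) → Op (HTensor E H))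
    (G' : (Fin n → Op K) → Op (HTensor E K)) : Prop :=
  ∃ A₁ A₂ : FreeMonoid (Fin n) → Op E,
    HasPluriharmonicExpansion γ A₁ A₂ G ∧ HasPluriharmonicExpansion γ A₁ A₂ G'

end Ball

end FreePluri
end

/-! Everything rests on one identity: for X in the open unit ball, 𝐏_X[Y ⊗ S_α] = Y ⊗ X_α
(`poisson_opTensor_wordProd`). It holds because K_X is an isometry with (S_j^* ⊗ I) K_X = K_X X_j^*,
so that K_X^* (S_α ⊗ I) K_X = X_α K_X^* K_X = X_α. Moreover 𝐏_X is bounded, linear and commutes with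
adjoints, so it is determined on the closure of 𝒫_n(E)^* + 𝒫_n(E) by its values on monomials.

For (a), the series of F₁ and F₂ converge in norm at rS, and their partial sums are polynomials,
which gives the membership. Applying 𝐏 at X/r term by term, the factor r^k from rS cancels r^{-k}
from X/r, and the series at X is recovered.

For (b), attach to f the Fourier coefficients `coef f α`. Bessel's inequality
(`sum_norm_sq_coef_le`) bounds each column (coef f α)_{|α| = k} by ‖f‖, so the analytic part ∑ coef
f α ⊗ X_α converges on the unit ball and is bounded in f. By density, 𝐏_X[f] is the analytic part of
f plus the adjoint of that of f^*, with the constant term counted once (`poisson_eq_tsum`). Since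
𝐏_{sS} multiplies the coefficient at α by s^{|α|}, the compatibility of φ forces coef (φ t) α =
t^{|α|} a_α with a independent of t; similarly b for φ^*. The Bessel bound for every t < γ makes the
radius of convergence of a and b at least γ. Thus v(X) = ∑ a_α ⊗ X_α + (∑_{α ≠ 1} b_α ⊗ X_α)^*, a
formula free of r, and S + T^* = Re(S + T) + i Re(-i(S - T)) shows it to be pluriharmonic. -/

noncomputable section

namespace FreePluri

/-! ### Calculus of tensor products of bounded operators -/

section TensorCalculus

variable {E : Type*} {F : Type*} {G : Type*} {E' : Type*} {F' : Type*} {E'' : Type*} {F'' : Type*}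
  [NormedAddCommGroup E] [InnerProductSpace ℂ E] [NormedAddCommGroup F] [InnerProductSpace ℂ F]
  [NormedAddCommGroup G] [InnerProductSpace ℂ G]
  [NormedAddCommGroup E'] [InnerProductSpace ℂ E'] [NormedAddCommGroup F'] [InnerProductSpace ℂ F']
  [NormedAddCommGroup E''] [InnerProductSpace ℂ E'']
  [NormedAddCommGroup F''] [InnerProductSpace ℂ F'']

theorem tmul_add (x : E) (y y' : F) : tmul x (y + y') = tmul x y + tmul x y' :=
  map_add (tmulLeft F x) y y'

theorem tmul_smul (c : ℂ) (x : E) (y : F) : tmul x (c • y) = c • tmul x y :=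
  map_smul (tmulLeft F x) c y

theorem add_tmul (x x' : E) (y : F) : tmul (x + x') y = tmul x y + tmul x' y :=
  DFunLike.congr_fun (tmulLeft_add (F := F) x x') y

theorem smul_tmul (c : ℂ) (x : E) (y : F) : tmul (c • x) y = c • tmul x y :=
  DFunLike.congr_fun (tmulLeft_smul (F := F) c x) y

theorem zero_tmul (y : F) : tmul (0 : E) y = 0 := by
  simpa using smul_tmul (0 : ℂ) (0 : E) y

theorem norm_tmul (x : E) (y : F) : ‖tmul x y‖ = ‖x‖ * ‖y‖ := by
  rw [tmul, UniformSpace.Completion.norm_coe, TensorProduct.norm_tmul]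

theorem clm_ext {T T' : HTensor E F →L[ℂ] G} (h : ∀ x y, T (tmul x y) = T' (tmul x y)) :
    T = T' := by
  ext z
  refine tensor_induction (p := fun z => T z = T' z) z (isClosed_eq T.continuous T'.continuous)
    (by simp) h ?_
  intro z z' hz hz'
  rw [map_add, map_add, hz, hz']

theorem opTensor_comp (A : E' →L[ℂ] E'') (B : F' →L[ℂ] F'') (A' : E →L[ℂ] E') (B' : F →L[ℂ] F') :
    opTensor A B ∘L opTensor A' B' = opTensor (A ∘L A') (B ∘L B') :=
  clm_ext fun x y => by simp [opTensor_tmul]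

theorem opTensor_mul (A A' : Op E) (B B' : Op F) :
    opTensor A B * opTensor A' B' = opTensor (A * A') (B * B') :=
  opTensor_comp A B A' B'

theorem opTensor_one : opTensor (1 : Op E) (1 : Op F) = 1 :=
  clm_ext fun x y => by simp [opTensor_tmul]

theorem opTensor_add_left (A A' : E →L[ℂ] E') (B : F →L[ℂ] F') :
    opTensor (A + A') B = opTensor A B + opTensor A' B :=
  clm_ext fun x y => by simp [opTensor_tmul, add_tmul]

theorem opTensor_smul_left (c : ℂ) (A : E →L[ℂ] E') (B : F →L[ℂ] F') :
    opTensor (c • A) B = c • opTensor A B :=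
  clm_ext fun x y => by simp [opTensor_tmul, smul_tmul]

theorem opTensor_add_right (A : E →L[ℂ] E') (B B' : F →L[ℂ] F') :
    opTensor A (B + B') = opTensor A B + opTensor A B' :=
  clm_ext fun x y => by simp [opTensor_tmul, tmul_add]

theorem opTensor_smul_right (c : ℂ) (A : E →L[ℂ] E') (B : F →L[ℂ] F') :
    opTensor A (c • B) = c • opTensor A B :=
  clm_ext fun x y => by simp [opTensor_tmul, tmul_smul]

/-- `A ↦ A ⊗ B` as a linear map. -/
def opTensorLeft (B : F →L[ℂ] F') : (E →L[ℂ] E') →ₗ[ℂ] (HTensor E F →L[ℂ] HTensor E' F') where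
  toFun A := opTensor A B
  map_add' A A' := opTensor_add_left A A' B
  map_smul' c A := opTensor_smul_left c A B

/-- `B ↦ A ⊗ B` as a linear map. -/
def opTensorRight (A : E →L[ℂ] E') : (F →L[ℂ] F') →ₗ[ℂ] (HTensor E F →L[ℂ] HTensor E' F') where
  toFun B := opTensor A B
  map_add' B B' := opTensor_add_right A B B'
  map_smul' c B := opTensor_smul_right c A B

theorem opTensor_zero_left (B : F →L[ℂ] F') : opTensor (0 : E →L[ℂ] E') B = 0 :=
  map_zero (opTensorLeft B)

theorem opTensor_zero_right (A : E →L[ℂ] E') : opTensor A (0 : F →L[ℂ] F') = 0 :=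
  map_zero (opTensorRight A)

theorem opTensor_sum_left {ι : Type*} (s : Finset ι) (A : ι → E →L[ℂ] E') (B : F →L[ℂ] F') :
    opTensor (∑ i ∈ s, A i) B = ∑ i ∈ s, opTensor (A i) B :=
  map_sum (opTensorLeft B) A s

theorem opTensor_sum_right {ι : Type*} (s : Finset ι) (A : E →L[ℂ] E') (B : ι → F →L[ℂ] F') :
    opTensor A (∑ i ∈ s, B i) = ∑ i ∈ s, opTensor A (B i) :=
  map_sum (opTensorRight A) B s

theorem norm_opTensor_le (A : E →L[ℂ] E') (B : F →L[ℂ] F') : ‖opTensor A B‖ ≤ ‖A‖ * ‖B‖ := by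
  refine ContinuousLinearMap.opNorm_le_bound _ (by positivity) fun z => ?_
  refine UniformSpace.Completion.induction_on z
    (isClosed_le (by fun_prop) (by fun_prop)) fun a => ?_
  have : opTensor A B (a : HTensor E F) = ((TensorProduct.mapL A B a : E' ⊗[ℂ] F') :
      HTensor E' F') := by
    simp [opTensor]
  rw [this, UniformSpace.Completion.norm_coe, UniformSpace.Completion.norm_coe]
  exact (TensorProduct.mapL A B).le_of_opNorm_le (TensorProduct.norm_mapL_le A B) a

theorem opTensor_adjoint [CompleteSpace E] [CompleteSpace E'] [CompleteSpace F] [CompleteSpace F']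
    (A : E →L[ℂ] E') (B : F →L[ℂ] F') :
    (opTensor A B).adjoint = opTensor A.adjoint B.adjoint := by
  refine clm_ext fun x y => ext_inner_left ℂ fun z => ?_
  refine tensor_induction (p := fun z => ⟪z, (opTensor A B).adjoint (tmul x y)⟫_ℂ =
    ⟪z, opTensor A.adjoint B.adjoint (tmul x y)⟫_ℂ) z
    (isClosed_eq (by fun_prop) (by fun_prop)) (by simp) ?_ ?_
  · intro x' y'
    rw [ContinuousLinearMap.adjoint_inner_right, opTensor_tmul, opTensor_tmul, inner_tmul,
      inner_tmul, ContinuousLinearMap.adjoint_inner_right, ContinuousLinearMap.adjoint_inner_right]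
  · intro z z' hz hz'
    rw [inner_add_left, inner_add_left, hz, hz']

theorem opTensor_star [CompleteSpace E] [CompleteSpace F] (A : Op E) (B : Op F) :
    star (opTensor A B) = opTensor (star A) (star B) :=
  opTensor_adjoint A B

/-- The bounded operator `x ↦ x ⊗ y`. -/
def tmulRight (E : Type*) [NormedAddCommGroup E] [InnerProductSpace ℂ E] (y : F) :
    E →L[ℂ] HTensor E F :=
  LinearMap.mkContinuous
    { toFun := fun x => tmul x y
      map_add' := fun x x' => add_tmul x x' y
      map_smul' := fun c x => smul_tmul c x y } ‖y‖ fun x => by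
    change ‖tmul x y‖ ≤ _
    rw [norm_tmul, mul_comm]

theorem assoc_intertwine (Y : E →L[ℂ] E') (T : F →L[ℂ] F') {G' : Type*} [NormedAddCommGroup G']
    [InnerProductSpace ℂ G'] (S : G →L[ℂ] G') :
    opTensor (opTensor Y T) S ∘L assoc E F G = assoc E' F' G' ∘L opTensor Y (opTensor T S) := by
  refine clm_ext fun x ζ => ?_
  -- With x fixed, both sides are bounded operators in the second factor, so `clm_ext` applies a
  -- second time and leaves only triple elementary tensors.
  suffices (opTensor (opTensor Y T) S ∘L assoc E F G) ∘L tmulLeft (HTensor F G) x =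
      (assoc E' F' G' ∘L opTensor Y (opTensor T S)) ∘L tmulLeft (HTensor F G) x from
    DFunLike.congr_fun this ζ
  refine clm_ext fun y z => ?_
  simp [tmulLeft_apply, assoc_tmul, opTensor_tmul]

theorem inner_assoc (a b : HTensor E (HTensor F G)) :
    ⟪assoc E F G a, assoc E F G b⟫_ℂ = ⟪a, b⟫_ℂ := by
  refine UniformSpace.Completion.induction_on₂ a b
    (isClosed_eq (by fun_prop) (by fun_prop)) fun a b => ?_
  rw [assoc, ContinuousLinearMap.fromCompletion_apply_coe,
    ContinuousLinearMap.fromCompletion_apply_coe, UniformSpace.Completion.inner_coe]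
  exact assocAux_inner a b

/-- Isometry of the associator is enough: the Poisson transform meets it only through its adjoint on
the left, so its surjectivity plays no role. -/
theorem assoc_adjoint_comp [CompleteSpace E] [CompleteSpace F] [CompleteSpace G] :
    (assoc E F G).adjoint ∘L assoc E F G = 1 := by
  ext a
  refine ext_inner_left ℂ fun b => ?_
  rw [ContinuousLinearMap.comp_apply, ContinuousLinearMap.adjoint_inner_right, inner_assoc]
  rfl

end TensorCalculus

/-! ### Creation operators on the Fock space -/

section FockSpace

variable {n : ℕ}

theorem fock_ext {G : Type*} [NormedAddCommGroup G] [NormedSpace ℂ G] {T T' : Fock n →L[ℂ] G}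
    (h : ∀ α, T (fockBasis α) = T' (fockBasis α)) : T = T' := by
  classical
  ext f
  have hf := lp.hasSum_single (E := fun _ : FreeMonoid (Fin n) => ℂ) (p := 2) (by simp) f
  refine (hf.mapL T).unique ?_
  convert hf.mapL T' using 1
  funext α
  have : lp.single (E := fun _ : FreeMonoid (Fin n) => ℂ) 2 α (f α) = f α • fockBasis α := by
    rw [fockBasis, ← lp.single_smul, smul_eq_mul, mul_one]
  rw [this, map_smul, map_smul, h]

open Classical in
theorem inner_fockBasis (α β : FreeMonoid (Fin n)) :
    ⟪fockBasis α, fockBasis β⟫_ℂ = if α = β then 1 else 0 :=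
  orthonormal_iff_ite.mp (orthonormal_fockBasis n) α β

theorem fock_ext_inner {x y : Fock n}
    (h : ∀ α, ⟪fockBasis α, x⟫_ℂ = ⟪fockBasis α, y⟫_ℂ) : x = y := by
  refine ext_inner_left ℂ fun v => ?_
  rw [← inner_conj_symm, ← inner_conj_symm v y]
  congr 1
  have : innerSL ℂ x = innerSL ℂ y := fock_ext fun α => by
    rw [innerSL_apply_apply, innerSL_apply_apply, ← inner_conj_symm, h, inner_conj_symm]
  exact DFunLike.congr_fun this v

theorem of_mul_inj {i j : Fin n} {α β : FreeMonoid (Fin n)} :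
    FreeMonoid.of i * α = FreeMonoid.of j * β ↔ i = j ∧ α = β :=
  List.cons_eq_cons

theorem of_mul_ne_one (i : Fin n) (α : FreeMonoid (Fin n)) : FreeMonoid.of i * α ≠ 1 :=
  List.cons_ne_nil _ _

theorem mul_of_inj {i j : Fin n} {α β : FreeMonoid (Fin n)} :
    α * FreeMonoid.of i = β * FreeMonoid.of j ↔ α = β ∧ i = j := by
  change (α.toList ++ [i] = β.toList ++ [j]) ↔ _
  refine ⟨fun h => ?_, fun h => by rw [h.1, h.2]⟩
  have := List.append_inj' h rfl
  exact ⟨this.1, List.singleton_injective this.2⟩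

theorem mul_of_ne_one (i : Fin n) (α : FreeMonoid (Fin n)) : α * FreeMonoid.of i ≠ 1 :=
  List.concat_ne_nil _ _

theorem star_leftCreation_one (i : Fin n) :
    star (leftCreation i) (fockBasis (1 : FreeMonoid (Fin n))) = 0 := by
  refine fock_ext_inner fun α => ?_
  rw [ContinuousLinearMap.star_eq_adjoint, ContinuousLinearMap.adjoint_inner_right,
    leftCreation_fockBasis, inner_fockBasis, if_neg (of_mul_ne_one i α), inner_zero_right]

theorem star_leftCreation_of_mul (i j : Fin n) (β : FreeMonoid (Fin n)) :
    star (leftCreation i) (fockBasis (FreeMonoid.of j * β)) =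
      if i = j then fockBasis β else 0 := by
  refine fock_ext_inner fun α => ?_
  rw [ContinuousLinearMap.star_eq_adjoint, ContinuousLinearMap.adjoint_inner_right,
    leftCreation_fockBasis, inner_fockBasis]
  by_cases h : i = j
  · subst h
    rw [if_pos rfl, inner_fockBasis]
    classical exact if_congr (of_mul_inj.trans (and_iff_right rfl)) rfl rfl
  · rw [if_neg h, if_neg (fun h' => h (of_mul_inj.mp h').1), inner_zero_right]

theorem star_rightCreation_one (i : Fin n) :
    star (rightCreation i) (fockBasis (1 : FreeMonoid (Fin n))) = 0 := by
  refine fock_ext_inner fun α => ?_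
  rw [ContinuousLinearMap.star_eq_adjoint, ContinuousLinearMap.adjoint_inner_right,
    rightCreation_fockBasis, inner_fockBasis, if_neg (mul_of_ne_one i α), inner_zero_right]

theorem star_rightCreation_mul (i j : Fin n) :
    star (rightCreation (n := n) i) * rightCreation j = if i = j then 1 else 0 := by
  refine fock_ext fun β => fock_ext_inner fun α => ?_
  rw [mul_apply_eq_comp, ContinuousLinearMap.star_eq_adjoint,
    ContinuousLinearMap.adjoint_inner_right,
    rightCreation_fockBasis, rightCreation_fockBasis, inner_fockBasis]
  by_cases h : i = j
  · subst h
    rw [if_pos rfl, one_apply_eq_self, inner_fockBasis]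
    classical exact if_congr (mul_of_inj.trans (and_iff_left rfl)) rfl rfl
  · rw [if_neg h, if_neg (fun h' => h (mul_of_inj.mp h').2)]
    simp

theorem star_leftCreation_mul (i j : Fin n) :
    star (leftCreation (n := n) i) * leftCreation j = if i = j then 1 else 0 := by
  refine fock_ext fun β => ?_
  rw [mul_apply_eq_comp, leftCreation_fockBasis, star_leftCreation_of_mul]
  split_ifs <;> simp

/-- The orthogonal projection onto the line spanned by the vacuum vector. -/
def vacuumProj (n : ℕ) : Op (Fock n) :=
  (innerSL ℂ (fockBasis (1 : FreeMonoid (Fin n)))).smulRight (fockBasis 1)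

theorem vacuumProj_apply (x : Fock n) :
    vacuumProj n x = ⟪fockBasis (1 : FreeMonoid (Fin n)), x⟫_ℂ • fockBasis 1 := rfl

theorem vacuumProj_mul_rightCreation (i : Fin n) : vacuumProj n * rightCreation i = 0 := by
  refine fock_ext fun α => ?_
  rw [mul_apply_eq_comp, vacuumProj_apply, rightCreation_fockBasis, inner_fockBasis,
    if_neg (mul_of_ne_one i α).symm, zero_smul]
  rfl

theorem vacuumProj_one :
    vacuumProj n (fockBasis 1) = fockBasis 1 := by
  rw [vacuumProj_apply, inner_fockBasis, if_pos rfl, one_smul]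

/-- Removing the first letter commutes with appending a last one, except on the vacuum, where the
appended letter is itself the first. The rank-one defect is what produces X_j^* in the intertwining
relation for the Poisson kernel. -/
theorem star_leftCreation_mul_rightCreation (i j : Fin n) :
    star (leftCreation (n := n) i) * rightCreation j =
      rightCreation j * star (leftCreation i) + if i = j then vacuumProj n else 0 := by
  refine fock_ext fun β => ?_
  simp only [mul_apply_eq_comp, add_apply]
  rw [rightCreation_fockBasis]
  refine FreeMonoid.casesOn β ?_ fun k γ => ?_
  · have := star_leftCreation_of_mul i j 1
    rw [mul_one] at this
    rw [one_mul, this, star_leftCreation_one, map_zero, zero_add]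
    split_ifs
    · rw [vacuumProj_one]
    · rfl
  · rw [mul_assoc, star_leftCreation_of_mul, star_leftCreation_of_mul]
    have : (if i = j then vacuumProj n else 0) (fockBasis (FreeMonoid.of k * γ)) = 0 := by
      split_ifs
      · rw [vacuumProj_apply, inner_fockBasis, if_neg (of_mul_ne_one k γ).symm, zero_smul]
      · rfl
    rw [this, add_zero]
    split_ifs
    · rw [rightCreation_fockBasis]
    · rw [map_zero]

end FockSpace

/-! ### The Poisson kernel and the Poisson transform -/

section PoissonKernel

variable {n : ℕ} {E : Type*} {H : Type*}
  [NormedAddCommGroup E] [InnerProductSpace ℂ E]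
  [NormedAddCommGroup H] [InnerProductSpace ℂ H] [CompleteSpace H]

theorem star_reconstruction (X : Fin n → Op H) :
    star (reconstruction X) = ∑ i, opTensor (star (rightCreation i)) (X i) := by
  simp only [reconstruction, star_sum, opTensor_star, star_star]

/-- The R_i have orthogonal ranges, so the cross terms vanish. This yields both ‖R_X‖ < 1 on the
unit ball and the link between R_X and the defect Δ_X. -/
theorem star_reconstruction_mul (X : Fin n → Op H) :
    star (reconstruction X) * reconstruction X =
      opTensor (1 : Op (Fock n)) (∑ i, X i * star (X i)) := by
  rw [star_reconstruction, reconstruction, Finset.sum_mul_sum, opTensor_sum_right]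
  refine Finset.sum_congr rfl fun i _ => ?_
  rw [Finset.sum_eq_single i]
  · rw [opTensor_mul, star_rightCreation_mul, if_pos rfl]
  · intro j _ hj
    rw [opTensor_mul, star_rightCreation_mul, if_neg hj.symm, opTensor_zero_left]
  · simp

theorem mem_ncBall_iff {X : Fin n → Op H} {γ : ℝ} (hγ : 0 < γ) :
    X ∈ ncBall H n γ ↔ ‖∑ i, X i * star (X i)‖ < γ ^ 2 := by
  rw [ncBall, Set.mem_ofPred_eq, Real.sqrt_lt' hγ]

theorem norm_reconstruction_lt_one {X : Fin n → Op H} (hX : X ∈ ncBall H n 1) :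
    ‖reconstruction X‖ < 1 := by
  rw [mem_ncBall_iff one_pos, one_pow] at hX
  have h : ‖reconstruction X‖ * ‖reconstruction X‖ ≤ ‖∑ i, X i * star (X i)‖ := by
    rw [← CStarRing.norm_star_mul_self, star_reconstruction_mul]
    refine (norm_opTensor_le _ _).trans ?_
    exact mul_le_of_le_one_left (norm_nonneg _) ContinuousLinearMap.norm_id_le
  nlinarith [norm_nonneg (reconstruction X)]

theorem one_sub_reconstruction_mul_inverse {X : Fin n → Op H} (hX : X ∈ ncBall H n 1) :
    (1 - reconstruction X) * Ring.inverse (1 - reconstruction X) = 1 :=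
  Ring.mul_inverse_cancel _ (isUnit_one_sub_of_norm_lt_one (norm_reconstruction_lt_one hX))

theorem inverse_mul_one_sub_reconstruction {X : Fin n → Op H} (hX : X ∈ ncBall H n 1) :
    Ring.inverse (1 - reconstruction X) * (1 - reconstruction X) = 1 :=
  Ring.inverse_mul_cancel _ (isUnit_one_sub_of_norm_lt_one (norm_reconstruction_lt_one hX))

/-- The map `h ↦ (I - R_X)⁻¹ (1 ⊗ h)`, that is `h ↦ ∑_α e_α ⊗ X_α^* h`. -/
def szegoKernel (X : Fin n → Op H) : H →L[ℂ] HTensor (Fock n) H :=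
  Ring.inverse (1 - reconstruction X) ∘L tmulLeft H (fockBasis (1 : FreeMonoid (Fin n)))

/-- This fixed-point equation stands in for the Neumann series in what follows. -/
theorem szegoKernel_eq {X : Fin n → Op H} (hX : X ∈ ncBall H n 1) (h : H) :
    szegoKernel X h = tmul (fockBasis 1) h + reconstruction X (szegoKernel X h) := by
  have := DFunLike.congr_fun (one_sub_reconstruction_mul_inverse hX) (tmul (fockBasis 1) h)
  rw [mul_apply_eq_comp, sub_apply] at this
  exact sub_eq_iff_eq_add.mp this

theorem inner_vacuum_reconstruction (X : Fin n → Op H) (h : H) (z : HTensor (Fock n) H) :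
    ⟪tmul (fockBasis (1 : FreeMonoid (Fin n))) h, reconstruction X z⟫_ℂ = 0 := by
  rw [← ContinuousLinearMap.adjoint_inner_left, ← ContinuousLinearMap.star_eq_adjoint,
    star_reconstruction, sum_apply]
  simp [opTensor_tmul, star_rightCreation_one, zero_tmul]

theorem inner_vacuum_szegoKernel {X : Fin n → Op H} (hX : X ∈ ncBall H n 1) (h h' : H) :
    ⟪tmul (fockBasis (1 : FreeMonoid (Fin n))) h, szegoKernel X h'⟫_ℂ = ⟪h, h'⟫_ℂ := by
  rw [szegoKernel_eq hX, inner_add_right, inner_vacuum_reconstruction, inner_tmul,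
    inner_fockBasis, if_pos rfl, one_mul, add_zero]

theorem sum_mul_star_nonneg {ι : Type*} (s : Finset ι) (X : ι → Op H) :
    0 ≤ ∑ i ∈ s, X i * star (X i) :=
  Finset.sum_nonneg fun i _ => mul_star_self_nonneg (X i)

theorem defect_mul_defect {X : Fin n → Op H} (hX : X ∈ ncBall H n 1) :
    defect X * defect X = 1 - ∑ i, X i * star (X i) := by
  rw [mem_ncBall_iff one_pos, one_pow] at hX
  refine CFC.sqrt_mul_sqrt_self _ (sub_nonneg.mpr ?_)
  exact (CStarAlgebra.norm_le_one_iff_of_nonneg _ (sum_mul_star_nonneg _ X)).mp hX.le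

theorem star_defect (X : Fin n → Op H) : star (defect X) = defect X :=
  (IsSelfAdjoint.of_nonneg (CFC.sqrt_nonneg _)).star_eq

theorem poissonKernel_eq (X : Fin n → Op H) :
    poissonKernel X = opTensor (1 : Op (Fock n)) (defect X) ∘L szegoKernel X := rfl

/-- With z = (I - R_X)⁻¹(1 ⊗ h) one has I ⊗ Δ_X² = I - R_X^* R_X and R_X z = z - 1 ⊗ h. Hence ‖K_X
h‖² = ‖z‖² - ‖z - 1 ⊗ h‖², which is ‖h‖² because z has vacuum component h. The proof is the
polarized form. -/
theorem poissonKernel_adjoint_comp {X : Fin n → Op H} (hX : X ∈ ncBall H n 1) :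
    (poissonKernel X).adjoint ∘L poissonKernel X = 1 := by
  ext h
  refine ext_inner_left ℂ fun h' => ?_
  have hD : opTensor (1 : Op (Fock n)) (defect X) * opTensor (1 : Op (Fock n)) (defect X) =
      1 - star (reconstruction X) * reconstruction X := by
    rw [opTensor_mul, defect_mul_defect hX, star_reconstruction_mul, one_mul]
    have := map_sub (opTensorRight (1 : Op (Fock n))) (1 : Op H) (∑ i, X i * star (X i))
    exact this.trans (congrArg (· - _) opTensor_one)
  have hZ : ∀ h, reconstruction X (szegoKernel X h) = szegoKernel X h - tmul (fockBasis 1) h :=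
    fun h => by rw [eq_sub_iff_add_eq, add_comm, ← szegoKernel_eq hX]
  rw [ContinuousLinearMap.comp_apply, ContinuousLinearMap.adjoint_inner_right, poissonKernel_eq,
    ContinuousLinearMap.comp_apply, ContinuousLinearMap.comp_apply,
    ← ContinuousLinearMap.adjoint_inner_right, ← ContinuousLinearMap.star_eq_adjoint,
    opTensor_star, star_one, star_defect, ← mul_apply_eq_comp, hD,
    sub_apply, inner_sub_right, mul_apply_eq_comp,
    ContinuousLinearMap.star_eq_adjoint, ContinuousLinearMap.adjoint_inner_right, hZ, hZ,
    inner_sub_left, inner_sub_right, inner_sub_right, inner_vacuum_szegoKernel hX,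
    ← inner_conj_symm (szegoKernel X h') (tmul _ _), inner_vacuum_szegoKernel hX,
    inner_conj_symm, inner_tmul, inner_fockBasis, if_pos rfl]
  simp

/-- Applying T = S_j^* ⊗ I to the fixed-point equation, with `star_leftCreation_mul_rightCreation`,
gives (I - R_X) T z = 1 ⊗ X_j^* h; then invert I - R_X. -/
theorem star_leftCreation_comp_szegoKernel {X : Fin n → Op H} (hX : X ∈ ncBall H n 1)
    (j : Fin n) (h : H) :
    opTensor (star (leftCreation j)) (1 : Op H) (szegoKernel X h) =
      szegoKernel X (star (X j) h) := by
  set T : Op (HTensor (Fock n) H) := opTensor (star (leftCreation j)) (1 : Op H)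
  have hTZ : T * reconstruction X =
      reconstruction X * T + opTensor (vacuumProj n) (star (X j)) := by
    simp only [T, reconstruction, Finset.mul_sum, Finset.sum_mul, opTensor_mul, one_mul, mul_one,
      star_leftCreation_mul_rightCreation, opTensor_add_left, Finset.sum_add_distrib]
    congr 1
    rw [Finset.sum_eq_single j]
    · rw [if_pos rfl]
    · intro i _ hi
      rw [if_neg hi.symm, opTensor_zero_left]
    · simp
  have hV : opTensor (vacuumProj n) (star (X j)) * reconstruction X = 0 := by
    simp only [reconstruction, Finset.mul_sum, opTensor_mul, vacuumProj_mul_rightCreation,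
      opTensor_zero_left, Finset.sum_const_zero]
  have hV' : opTensor (vacuumProj n) (star (X j)) (szegoKernel X h) =
      tmul (fockBasis 1) (star (X j) h) := by
    rw [szegoKernel_eq hX, map_add, ← mul_apply_eq_comp, hV, opTensor_tmul,
      vacuumProj_one]
    simp
  have hT : (1 - reconstruction X) (T (szegoKernel X h)) = tmul (fockBasis 1) (star (X j) h) := by
    rw [sub_apply, one_apply_eq_self, sub_eq_iff_eq_add]
    conv_lhs => rw [szegoKernel_eq hX, map_add, ← mul_apply_eq_comp, hTZ,
      add_apply, hV', mul_apply_eq_comp, opTensor_tmul,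
      star_leftCreation_one, zero_tmul, zero_add, add_comm]
  have := DFunLike.congr_fun (inverse_mul_one_sub_reconstruction hX) (T (szegoKernel X h))
  rw [mul_apply_eq_comp, hT] at this
  exact this.symm

theorem star_leftCreation_comp_poissonKernel {X : Fin n → Op H} (hX : X ∈ ncBall H n 1)
    (j : Fin n) :
    opTensor (star (leftCreation j)) (1 : Op H) ∘L poissonKernel X =
      poissonKernel X ∘L star (X j) := by
  ext h
  rw [poissonKernel_eq, ContinuousLinearMap.comp_apply, ContinuousLinearMap.comp_apply,
    ContinuousLinearMap.comp_apply, ContinuousLinearMap.comp_apply,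
    ← star_leftCreation_comp_szegoKernel hX, ← mul_apply_eq_comp,
    ← mul_apply_eq_comp, opTensor_mul, opTensor_mul]
  simp

theorem poissonKernel_adjoint_comp_leftCreation {X : Fin n → Op H} (hX : X ∈ ncBall H n 1)
    (j : Fin n) :
    (poissonKernel X).adjoint ∘L opTensor (leftCreation j) (1 : Op H) =
      X j ∘L (poissonKernel X).adjoint := by
  have := congrArg ContinuousLinearMap.adjoint (star_leftCreation_comp_poissonKernel hX j)
  rwa [ContinuousLinearMap.adjoint_comp, ContinuousLinearMap.adjoint_comp, opTensor_adjoint,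
    ← ContinuousLinearMap.star_eq_adjoint, star_star, ← ContinuousLinearMap.star_eq_adjoint,
    star_one, ← ContinuousLinearMap.star_eq_adjoint (star (X j)), star_star] at this

theorem poissonKernel_adjoint_comp_wordProd {X : Fin n → Op H} (hX : X ∈ ncBall H n 1)
    (α : FreeMonoid (Fin n)) :
    (poissonKernel X).adjoint ∘L opTensor (wordProd leftCreation α) (1 : Op H) =
      wordProd X α ∘L (poissonKernel X).adjoint := by
  refine FreeMonoid.recOn α ?_ fun i β ih => ?_
  · simp only [wordProd, map_one, opTensor_one]
    rfl
  · have h1 : opTensor (wordProd leftCreation (FreeMonoid.of i * β)) (1 : Op H) =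
        opTensor (leftCreation i) (1 : Op H) ∘L opTensor (wordProd leftCreation β) (1 : Op H) := by
      rw [opTensor_comp]
      simp only [wordProd, map_mul, FreeMonoid.lift_eval_of]
      rfl
    have h2 : wordProd X (FreeMonoid.of i * β) = X i ∘L wordProd X β := by
      simp only [wordProd, map_mul, FreeMonoid.lift_eval_of]
      rfl
    rw [h1, ← ContinuousLinearMap.comp_assoc, poissonKernel_adjoint_comp_leftCreation hX,
      ContinuousLinearMap.comp_assoc, ih, ← ContinuousLinearMap.comp_assoc, ← h2]

/-- Naturality of the associator carries Y ⊗ T ⊗ I through it, and the associator then cancels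
against its adjoint. -/
theorem poisson_opTensor [CompleteSpace E] (X : Fin n → Op H) (Y : Op E) (T : Op (Fock n)) :
    poisson X (opTensor Y T) =
      opTensor Y ((poissonKernel X).adjoint ∘L opTensor T (1 : Op H) ∘L poissonKernel X) := by
  rw [poisson, poissonKernelE, ContinuousLinearMap.adjoint_comp, ContinuousLinearMap.comp_assoc,
    ← ContinuousLinearMap.comp_assoc (opTensor (opTensor Y T) 1), assoc_intertwine,
    ← ContinuousLinearMap.comp_assoc (assoc E (Fock n) H).adjoint,
    ← ContinuousLinearMap.comp_assoc (assoc E (Fock n) H).adjoint, assoc_adjoint_comp,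
    opTensor_adjoint]
  change opTensor (1 : Op E).adjoint _ ∘L opTensor Y _ ∘L opTensor (1 : Op E) _ = _
  rw [opTensor_comp, opTensor_comp, ← ContinuousLinearMap.star_eq_adjoint, star_one]
  rfl

theorem poisson_opTensor_wordProd [CompleteSpace E] {X : Fin n → Op H} (hX : X ∈ ncBall H n 1)
    (Y : Op E) (α : FreeMonoid (Fin n)) :
    poisson X (opTensor Y (wordProd leftCreation α)) = opTensor Y (wordProd X α) := by
  rw [poisson_opTensor, ← ContinuousLinearMap.comp_assoc, poissonKernel_adjoint_comp_wordProd hX,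
    ContinuousLinearMap.comp_assoc, poissonKernel_adjoint_comp hX]
  rfl

theorem poisson_star (X : Fin n → Op H) (f : Op (HTensor E (Fock n))) :
    poisson X (star f) = star (poisson X f) := by
  rw [poisson, poisson, ContinuousLinearMap.star_eq_adjoint (_ ∘L _),
    ContinuousLinearMap.adjoint_comp, ContinuousLinearMap.adjoint_comp,
    ContinuousLinearMap.adjoint_adjoint, opTensor_adjoint, ContinuousLinearMap.comp_assoc,
    ← ContinuousLinearMap.star_eq_adjoint (1 : Op H), star_one]
  rfl

/-- The Poisson transform as a bounded linear map. -/
def poissonCLM (E : Type*) [NormedAddCommGroup E] [InnerProductSpace ℂ E]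
    (X : Fin n → Op H) : Op (HTensor E (Fock n)) →L[ℂ] Op (HTensor E H) :=
  LinearMap.mkContinuous
    { toFun := poisson X
      map_add' := fun f g => by
        simp only [poisson, opTensor_add_left, ContinuousLinearMap.add_comp,
          ContinuousLinearMap.comp_add]
      map_smul' := fun c f => by
        simp only [poisson, opTensor_smul_left, ContinuousLinearMap.smul_comp,
          ContinuousLinearMap.comp_smul, RingHom.id_apply] }
    (‖(poissonKernelE E X).adjoint‖ * ‖(1 : Op H)‖ * ‖poissonKernelE E X‖) fun f => by
      change ‖(poissonKernelE E X).adjoint ∘L opTensor f (1 : Op H) ∘L poissonKernelE E X‖ ≤ _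
      grw [ContinuousLinearMap.opNorm_comp_le, ContinuousLinearMap.opNorm_comp_le,
        norm_opTensor_le]
      exact le_of_eq (by ring)

theorem poissonCLM_apply (X : Fin n → Op H) (f : Op (HTensor E (Fock n))) :
    poissonCLM E X f = poisson X f := rfl

end PoissonKernel

/-! ### Norms of rows and columns of operators -/

section RowBounds

variable {ι : Type*} [Fintype ι] {E : Type*} {H : Type*}
  [NormedAddCommGroup E] [InnerProductSpace ℂ E] [CompleteSpace E]
  [NormedAddCommGroup H] [InnerProductSpace ℂ H] [CompleteSpace H]

theorem sum_norm_sq_le (A : ι → Op E) (x : E) :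
    ∑ i, ‖A i x‖ ^ 2 ≤ ‖∑ i, star (A i) * A i‖ * ‖x‖ ^ 2 := by
  have h : ((∑ i, ‖A i x‖ ^ 2 : ℝ) : ℂ) = ⟪x, (∑ i, star (A i) * A i) x⟫_ℂ := by
    rw [sum_apply, inner_sum]
    push_cast
    refine Finset.sum_congr rfl fun i _ => ?_
    change _ = ⟪x, star (A i) (A i x)⟫_ℂ
    rw [ContinuousLinearMap.star_eq_adjoint,
      ContinuousLinearMap.adjoint_inner_right, inner_self_eq_norm_sq_to_K]
    rfl
  have h0 : 0 ≤ ∑ i, ‖A i x‖ ^ 2 := by positivity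
  rw [← abs_of_nonneg h0, ← Real.norm_eq_abs, ← Complex.norm_real, h]
  refine (norm_inner_le_norm _ _).trans ?_
  grw [ContinuousLinearMap.le_opNorm]
  exact le_of_eq (by ring)

/-- The sum is the row (S_i^*) times the column (T_i), and the hypotheses bound both by c and d;
this is Cauchy–Schwarz over the index set. -/
theorem norm_sum_star_mul_le {S T : ι → Op E} {c d : ℝ} (hc : 0 ≤ c) (hd : 0 ≤ d)
    (hS : ∀ x, ∑ i, ‖S i x‖ ^ 2 ≤ c ^ 2 * ‖x‖ ^ 2) (hT : ∀ x, ∑ i, ‖T i x‖ ^ 2 ≤ d ^ 2 * ‖x‖ ^ 2) :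
    ‖∑ i, star (S i) * T i‖ ≤ c * d := by
  refine ContinuousLinearMap.opNorm_le_bound _ (by positivity) fun x => ?_
  set y := (∑ i, star (S i) * T i) x with hy
  have h1 : ‖y‖ ^ 2 ≤ ∑ i, ‖S i y‖ * ‖T i x‖ := by
    have : ((‖y‖ ^ 2 : ℝ) : ℂ) = ∑ i, ⟪S i y, T i x⟫_ℂ := by
      push_cast
      rw [← RCLike.ofReal_eq_complex_ofReal, ← inner_self_eq_norm_sq_to_K (𝕜 := ℂ)]
      conv_lhs => rw [hy, sum_apply, inner_sum]
      refine Finset.sum_congr rfl fun i _ => ?_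
      rw [mul_apply_eq_comp, ContinuousLinearMap.star_eq_adjoint,
        ContinuousLinearMap.adjoint_inner_right]
      rw [hy, sum_apply]
    rw [← abs_of_nonneg (sq_nonneg ‖y‖), ← Real.norm_eq_abs, ← Complex.norm_real, this]
    exact (norm_sum_le _ _).trans (Finset.sum_le_sum fun i _ => norm_inner_le_norm _ _)
  have h2 : (∑ i, ‖S i y‖ * ‖T i x‖) ^ 2 ≤ (c * ‖y‖ * (d * ‖x‖)) ^ 2 := by
    refine (Finset.sum_mul_sq_le_sq_mul_sq _ _ _).trans ?_
    rw [mul_pow, mul_pow c, mul_pow d]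
    exact mul_le_mul (hS y) (hT x) (by positivity) (by positivity)
  have h3 := h1.trans (abs_le_of_sq_le_sq' h2 (by positivity)).2
  by_contra! hlt
  have hy0 : 0 < ‖y‖ := lt_of_le_of_lt (by positivity) hlt
  nlinarith

theorem norm_sum_star_mul_self_le {A : ι → Op E} {c : ℝ} (hc : 0 ≤ c)
    (hA : ∀ x, ∑ i, ‖A i x‖ ^ 2 ≤ c ^ 2 * ‖x‖ ^ 2) : ‖∑ i, star (A i) * A i‖ ≤ c ^ 2 := by
  rw [sq]
  exact norm_sum_star_mul_le hc hc hA hA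

/-- Factor A_i ⊗ B_i = (I ⊗ B_i)(A_i ⊗ I), a row times a column. -/
theorem norm_sum_opTensor_le {A : ι → Op E} {B : ι → Op H} {c d : ℝ} (hc : 0 ≤ c) (hd : 0 ≤ d)
    (hA : ‖∑ i, star (A i) * A i‖ ≤ c ^ 2) (hB : ‖∑ i, B i * star (B i)‖ ≤ d ^ 2) :
    ‖∑ i, opTensor (A i) (B i)‖ ≤ d * c := by
  have h := norm_sum_star_mul_le (S := fun i => opTensor (1 : Op E) (star (B i)))
    (T := fun i => opTensor (A i) (1 : Op H)) hd hc ?_ ?_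
  · simpa only [opTensor_star, star_star, star_one, opTensor_mul, one_mul, mul_one] using h
  · refine fun x => (sum_norm_sq_le _ x).trans (mul_le_mul_of_nonneg_right ?_ (by positivity))
    simp only [opTensor_star, star_star, star_one, opTensor_mul, one_mul]
    rw [← opTensor_sum_right]
    refine (norm_opTensor_le _ _).trans ?_
    grw [hB]
    exact mul_le_of_le_one_left (by positivity) ContinuousLinearMap.norm_id_le
  · refine fun x => (sum_norm_sq_le _ x).trans (mul_le_mul_of_nonneg_right ?_ (by positivity))
    simp only [opTensor_star, star_one, opTensor_mul, one_mul]
    rw [← opTensor_sum_left]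
    refine (norm_opTensor_le _ _).trans ?_
    grw [hA]
    exact mul_le_of_le_one_right (by positivity) ContinuousLinearMap.norm_id_le

end RowBounds

/-! ### Monomials X_α of a given degree -/

section Words

variable {n : ℕ} {H : Type*} [NormedAddCommGroup H] [InnerProductSpace ℂ H]

theorem word_cons {k : ℕ} (i : Fin n) (w : Fin k → Fin n) :
    word (Fin.cons i w : Fin (k + 1) → Fin n) = FreeMonoid.of i * word w := by
  simp [word, List.ofFn_succ, FreeMonoid.ofList_cons]

theorem length_word {k : ℕ} (w : Fin k → Fin n) : (word w).length = k :=
  List.length_ofFn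

theorem word_injective {k : ℕ} : Function.Injective (word : (Fin k → Fin n) → _) :=
  List.ofFn_injective

theorem exists_eq_word (α : FreeMonoid (Fin n)) : ∃ (k : ℕ) (w : Fin k → Fin n), α = word w :=
  ⟨_, α.toList.get, (List.ofFn_get α.toList).symm⟩

theorem wordProd_one (X : Fin n → Op H) : wordProd X 1 = 1 := map_one _

theorem wordProd_of_mul (X : Fin n → Op H) (i : Fin n) (α : FreeMonoid (Fin n)) :
    wordProd X (FreeMonoid.of i * α) = X i * wordProd X α := by
  rw [wordProd, map_mul, FreeMonoid.lift_eval_of, wordProd]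

theorem wordProd_smul (c : ℂ) (X : Fin n → Op H) (α : FreeMonoid (Fin n)) :
    wordProd (c • X) α = c ^ α.length • wordProd X α := by
  refine FreeMonoid.recOn α ?_ fun i β ih => ?_
  · rw [wordProd_one, wordProd_one, FreeMonoid.length_one, pow_zero, one_smul]
  · rw [wordProd_of_mul, wordProd_of_mul, ih, FreeMonoid.length_mul, FreeMonoid.length_of,
      Pi.smul_apply, smul_mul_smul_comm, pow_add, pow_one]

variable [CompleteSpace H]

/-- Induction on the length: as (X_i X_w)^* = X_w^* X_i^*, the inductive bound is applied to the
vectors X_i^* h, and the sum over i costs one factor ρ². -/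
theorem sum_norm_sq_star_wordProd_le {X : Fin n → Op H} {ρ : ℝ}
    (hX : ‖∑ i, X i * star (X i)‖ ≤ ρ ^ 2) (k : ℕ) (h : H) :
    ∑ w : Fin k → Fin n, ‖star (wordProd X (word w)) h‖ ^ 2 ≤ (ρ ^ k) ^ 2 * ‖h‖ ^ 2 := by
  induction k generalizing h with
  | zero =>
    have : ∀ w : Fin 0 → Fin n, word w = 1 := fun w => by simp [word]
    simp [this, wordProd_one]
  | succ k ih =>
    rw [← (Fin.consEquiv fun _ : Fin (k + 1) => Fin n).sum_comp, Fintype.sum_prod_type]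
    calc _ = ∑ i, ∑ w : Fin k → Fin n, ‖star (wordProd X (word w)) (star (X i) h)‖ ^ 2 := by
          refine Finset.sum_congr rfl fun i _ => Finset.sum_congr rfl fun w _ => ?_
          have : (Fin.consEquiv fun _ : Fin (k + 1) => Fin n) (i, w) = Fin.cons i w := rfl
          rw [this, word_cons, wordProd_of_mul, star_mul, mul_apply_eq_comp]
      _ ≤ ∑ i, (ρ ^ k) ^ 2 * ‖star (X i) h‖ ^ 2 := Finset.sum_le_sum fun i _ => ih _
      _ ≤ (ρ ^ k) ^ 2 * (ρ ^ 2 * ‖h‖ ^ 2) := by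
          rw [← Finset.mul_sum]
          refine mul_le_mul_of_nonneg_left ?_ (by positivity)
          refine (sum_norm_sq_le (fun i => star (X i)) h).trans ?_
          simp only [star_star]
          gcongr
      _ = _ := by ring

theorem norm_sum_wordProd_le {X : Fin n → Op H} {ρ : ℝ} (hρ : 0 ≤ ρ)
    (hX : ‖∑ i, X i * star (X i)‖ ≤ ρ ^ 2) (k : ℕ) :
    ‖∑ w : Fin k → Fin n, wordProd X (word w) * star (wordProd X (word w))‖ ≤ (ρ ^ k) ^ 2 := by
  have := norm_sum_star_mul_self_le (A := fun w : Fin k → Fin n => star (wordProd X (word w)))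
    (pow_nonneg hρ k) (sum_norm_sq_star_wordProd_le hX k)
  simpa only [star_star] using this

end Words

/-! ### Radius of convergence and power series -/

section Series

variable {n : ℕ} {E : Type*} {H : Type*}
  [NormedAddCommGroup E] [InnerProductSpace ℂ E]
  [NormedAddCommGroup H] [InnerProductSpace ℂ H]

/-- The homogeneous part `∑_{|α| = k} A_(α) ⊗ X_α` of degree `k`. -/
def homogPart (A : FreeMonoid (Fin n) → Op E) (X : Fin n → Op H) (k : ℕ) : Op (HTensor E H) :=
  ∑ w : Fin k → Fin n, opTensor (A (word w)) (wordProd X (word w))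

theorem homogPart_add (A B : FreeMonoid (Fin n) → Op E) (X : Fin n → Op H) (k : ℕ) :
    homogPart (A + B) X k = homogPart A X k + homogPart B X k := by
  simp only [homogPart, Pi.add_apply, opTensor_add_left, Finset.sum_add_distrib]

theorem homogPart_smul (c : ℂ) (A : FreeMonoid (Fin n) → Op E) (X : Fin n → Op H) (k : ℕ) :
    homogPart (c • A) X k = c • homogPart A X k := by
  simp only [homogPart, Pi.smul_apply, opTensor_smul_left, Finset.smul_sum]

theorem homogPart_smul_right (c : ℂ) (A : FreeMonoid (Fin n) → Op E) (X : Fin n → Op H) (k : ℕ) :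
    homogPart A (c • X) k = c ^ k • homogPart A X k := by
  simp only [homogPart, wordProd_smul, length_word, opTensor_smul_right, Finset.smul_sum]

/-- The linear span of the elementary tensors `Y ⊗ T`. -/
abbrev elementarySpan (E H : Type*) [NormedAddCommGroup E] [InnerProductSpace ℂ E]
    [NormedAddCommGroup H] [InnerProductSpace ℂ H] : Submodule ℂ (Op (HTensor E H)) :=
  Submodule.span ℂ {T | ∃ (Y : Op E) (Z : Op H), T = opTensor Y Z}

theorem homogPart_mem (A : FreeMonoid (Fin n) → Op E) (X : Fin n → Op H) (k : ℕ) :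
    homogPart A X k ∈ elementarySpan E H :=
  Submodule.sum_mem _ fun _ _ => Submodule.subset_span ⟨_, _, rfl⟩

theorem minTensor_add {S T : Op (HTensor E H)} (hS : S ∈ minTensor E H) (hT : T ∈ minTensor E H) :
    S + T ∈ minTensor E H :=
  (elementarySpan E H).topologicalClosure.add_mem hS hT

theorem minTensor_smul (c : ℂ) {T : Op (HTensor E H)} (hT : T ∈ minTensor E H) :
    c • T ∈ minTensor E H :=
  (elementarySpan E H).topologicalClosure.smul_mem c hT

variable [CompleteSpace E] [CompleteSpace H]

theorem minTensor_star {T : Op (HTensor E H)} (hT : T ∈ minTensor E H) :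
    star T ∈ minTensor E H := by
  refine map_mem_closure continuous_star hT fun T hT => ?_
  refine Submodule.span_induction ?_ ?_ ?_ ?_ hT
  · rintro _ ⟨Y, Z, rfl⟩
    rw [opTensor_star]
    exact Submodule.subset_span ⟨_, _, rfl⟩
  · rw [star_zero]
    exact Submodule.zero_mem _
  · intro S T _ _ hS hT
    rw [star_add]
    exact Submodule.add_mem _ hS hT
  · intro c T _ hT
    rw [star_smul]
    exact Submodule.smul_mem _ _ hT

theorem minTensor_rePart {T : Op (HTensor E H)} (hT : T ∈ minTensor E H) :
    rePart T ∈ minTensor E H :=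
  minTensor_smul _ (minTensor_add hT (minTensor_star hT))

theorem eventually_le_of_le_radius {γ : ℝ} {A : FreeMonoid (Fin n) → Op E}
    (hA : ENNReal.ofReal γ ≤ radius A) {t : ℝ} (ht : 0 < t) (htγ : t < γ) :
    ∀ᶠ k : ℕ in atTop, ‖∑ w : Fin k → Fin n, star (A (word w)) * A (word w)‖ ≤
      ((1 / t) ^ k) ^ 2 := by
  have h : radius A > ENNReal.ofReal t :=
    lt_of_lt_of_le ((ENNReal.ofReal_lt_ofReal_iff (ht.trans htγ)).mpr htγ) hA
  rw [radius, gt_iff_lt, ENNReal.lt_inv_iff_lt_inv] at h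
  -- Degree 0 is discarded: there 1/(2k) is 0 by convention and the root cannot be undone.
  filter_upwards [eventually_lt_of_limsup_lt h, eventually_gt_atTop 0] with k hk hk0
  have hk' : (0 : ℝ) < 2 * k := by positivity
  rw [← ENNReal.ofReal_inv_of_pos ht] at hk
  rw [one_div] at hk
  have hk2 := (ENNReal.rpow_inv_le_iff hk').mp hk.le
  rw [ENNReal.ofReal_rpow_of_nonneg (by positivity) hk'.le, ← ofReal_norm,
    ENNReal.ofReal_le_ofReal_iff (by positivity)] at hk2
  refine hk2.trans (le_of_eq ?_)
  rw [one_div, ← pow_mul, ← Real.rpow_natCast]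
  congr 1
  push_cast
  ring

theorem le_radius_of_eventually_le {γ : ℝ} {A : FreeMonoid (Fin n) → Op E}
    (hA : ∀ t : ℝ, 0 < t → t < γ → ∀ᶠ k : ℕ in atTop,
      ‖∑ w : Fin k → Fin n, star (A (word w)) * A (word w)‖ ≤ ((1 / t) ^ k) ^ 2) :
    ENNReal.ofReal γ ≤ radius A := by
  refine le_of_forall_lt fun c hc => ?_
  obtain ⟨d, hcd, hd⟩ := exists_between hc
  refine hcd.trans_le ?_
  have hd0 : 0 < d := bot_le.trans_lt hcd
  have hdtop : d ≠ ⊤ := (hd.trans ENNReal.ofReal_lt_top).ne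
  obtain ⟨t, ht, rfl⟩ : ∃ t : ℝ, 0 < t ∧ d = ENNReal.ofReal t :=
    ⟨d.toReal, ENNReal.toReal_pos hd0.ne' hdtop, (ENNReal.ofReal_toReal hdtop).symm⟩
  have htγ : t < γ := (ENNReal.ofReal_lt_ofReal_iff_of_nonneg ht.le).mp hd
  rw [radius, ENNReal.le_inv_iff_le_inv]
  refine limsup_le_of_le (by isBoundedDefault) ?_
  filter_upwards [hA t ht htγ, eventually_gt_atTop 0] with k hk hk0
  have hk' : (0 : ℝ) < 2 * k := by positivity
  rw [← ENNReal.ofReal_inv_of_pos ht, one_div, ENNReal.rpow_inv_le_iff hk',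
    ENNReal.ofReal_rpow_of_nonneg (by positivity) hk'.le, ← ofReal_norm,
    ENNReal.ofReal_le_ofReal_iff (by positivity)]
  refine hk.trans (le_of_eq ?_)
  rw [one_div, ← pow_mul, ← Real.rpow_natCast]
  congr 1
  push_cast
  ring

/-- A constant is harmless: use the bound at some s in (t, γ) and absorb C into (t/s)^{2k}, which
tends to 0. -/
theorem le_radius_of_geometric_bound {γ : ℝ} {A : FreeMonoid (Fin n) → Op E}
    (hA : ∀ t : ℝ, 0 < t → t < γ → ∃ C : ℝ, ∀ k : ℕ,
      ‖∑ w : Fin k → Fin n, star (A (word w)) * A (word w)‖ ≤ C * ((1 / t) ^ k) ^ 2) :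
    ENNReal.ofReal γ ≤ radius A := by
  refine le_radius_of_eventually_le fun t ht htγ => ?_
  obtain ⟨s, hts, hsγ⟩ := exists_between htγ
  have hs : 0 < s := ht.trans hts
  obtain ⟨C, hC⟩ := hA s hs hsγ
  have hlim : Tendsto (fun k : ℕ => C * ((t / s) ^ 2) ^ k) atTop (𝓝 (C * 0)) := by
    refine (tendsto_pow_atTop_nhds_zero_of_lt_one (by positivity) ?_).const_mul C
    exact pow_lt_one₀ (by positivity) ((div_lt_one hs).mpr hts) two_ne_zero
  rw [mul_zero] at hlim
  filter_upwards [hlim.eventually_lt_const one_pos] with k hk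
  refine (hC k).trans ?_
  have : C * ((1 / s) ^ k) ^ 2 = C * ((t / s) ^ 2) ^ k * ((1 / t) ^ k) ^ 2 := by
    rw [← pow_mul, ← pow_mul, ← pow_mul, mul_comm 2 k, mul_assoc, ← mul_pow]
    congr 2
    field_simp
  rw [this]
  exact mul_le_of_le_one_left (by positivity) hk.le

theorem summable_homogPart {γ : ℝ} {A : FreeMonoid (Fin n) → Op E}
    (hA : ENNReal.ofReal γ ≤ radius A) {X : Fin n → Op H} (hX : X ∈ ncBall H n γ) :
    Summable (homogPart A X) := by
  obtain ⟨t, hρt, htγ⟩ := exists_between (show Real.sqrt ‖∑ i, X i * star (X i)‖ < γ from hX)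
  set ρ := Real.sqrt ‖∑ i, X i * star (X i)‖
  have hρ : 0 ≤ ρ := Real.sqrt_nonneg _
  have ht : 0 < t := hρ.trans_lt hρt
  refine Summable.of_norm_bounded_eventually_nat (g := fun k => (ρ / t) ^ k)
    (summable_geometric_of_lt_one (by positivity) ((div_lt_one ht).mpr hρt)) ?_
  filter_upwards [eventually_le_of_le_radius hA ht htγ] with k hk
  refine (norm_sum_opTensor_le (by positivity) (by positivity) hk
    (norm_sum_wordProd_le hρ (Real.sq_sqrt (norm_nonneg _)).ge k)).trans (le_of_eq ?_)
  rw [← mul_pow, mul_one_div]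

/-- The condition on the radius involves the coefficients alone, so they define a function on the
ball over any Hilbert space; representations on the Fock space come from here. -/
theorem hasHolomorphicExpansion_tsum {γ : ℝ} {A : FreeMonoid (Fin n) → Op E}
    (hA : ENNReal.ofReal γ ≤ radius A) :
    HasHolomorphicExpansion (H := H) γ A (fun X => ∑' k, homogPart A X k) where
  le_radius := hA
  tendsto _ hX := (summable_homogPart hA hX).hasSum.tendsto_sum_nat
  mem_minTensor _ hX := mem_closure_of_tendsto (summable_homogPart hA hX).hasSum.tendsto_sum_nat
    (Eventually.of_forall fun _ => Submodule.sum_mem _ fun _ _ => homogPart_mem _ _ _)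

theorem hasPluriharmonicExpansion_of_holomorphic {γ : ℝ} {A₁ A₂ : FreeMonoid (Fin n) → Op E}
    {F₁ F₂ : (Fin n → Op H) → Op (HTensor E H)} (h₁ : HasHolomorphicExpansion γ A₁ F₁)
    (h₂ : HasHolomorphicExpansion γ A₂ F₂) {G : (Fin n → Op H) → Op (HTensor E H)}
    (hG : ∀ X ∈ ncBall H n γ, G X = rePart (F₁ X) + Complex.I • rePart (F₂ X)) :
    HasPluriharmonicExpansion γ A₁ A₂ G := by
  refine ⟨fun X hX => ?_, F₁, F₂, h₁, h₂, hG⟩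
  rw [hG X hX]
  exact minTensor_add (minTensor_rePart (h₁.mem_minTensor X hX))
    (minTensor_smul _ (minTensor_rePart (h₂.mem_minTensor X hX)))

end Series

/-! ### The closure of 𝒫_n(E)^* + 𝒫_n(E) -/

section HarmonicSpace

variable {n : ℕ} {E : Type*} [NormedAddCommGroup E] [InnerProductSpace ℂ E]

theorem wordProd_leftCreation_mem_polys (α : FreeMonoid (Fin n)) :
    wordProd leftCreation α ∈ polys n := by
  refine FreeMonoid.recOn α ?_ fun i β ih => ?_
  · rw [wordProd_one]
    exact one_mem _
  · rw [wordProd_of_mul]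
    exact mul_mem (Algebra.subset_adjoin ⟨i, rfl⟩) ih

theorem opTensor_wordProd_mem_polysE (Y : Op E) (α : FreeMonoid (Fin n)) :
    opTensor Y (wordProd leftCreation α) ∈ polysE n E :=
  Submodule.subset_span ⟨Y, _, wordProd_leftCreation_mem_polys α, rfl⟩

theorem mem_span_wordProd_of_mem_polys {p : Op (Fock n)} (hp : p ∈ polys n) :
    p ∈ Submodule.span ℂ (Set.range fun α => wordProd (leftCreation (n := n)) α) := by
  have h : p ∈ Subalgebra.toSubmodule (polys n) := hp
  rw [polys, Algebra.adjoin_eq_span, ← FreeMonoid.mrange_lift] at h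
  exact h

theorem polysE_induction {p : Op (HTensor E (Fock n)) → Prop}
    (hadd : ∀ f g, p f → p g → p (f + g)) (hsmul : ∀ (c : ℂ) f, p f → p (c • f))
    (hgen : ∀ Y α, p (opTensor Y (wordProd leftCreation α)))
    {f : Op (HTensor E (Fock n))} (hf : f ∈ polysE n E) : p f := by
  have h0 : p 0 := by simpa using hsmul 0 _ (hgen 0 1)
  refine Submodule.span_induction ?_ h0 (fun f g _ _ => hadd f g) (fun c f _ => hsmul c f) hf
  rintro _ ⟨Y, T, hT, rfl⟩
  refine Submodule.span_induction ?_ ?_ ?_ ?_ (mem_span_wordProd_of_mem_polys hT)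
  · rintro _ ⟨α, rfl⟩
    exact hgen Y α
  · rwa [opTensor_zero_right]
  · intro S T _ _ hS hT
    rw [opTensor_add_right]
    exact hadd _ _ hS hT
  · intro c T _ hT
    rw [opTensor_smul_right]
    exact hsmul _ _ hT

/-- The self-adjoint space `𝒫_n(E)^* + 𝒫_n(E)`. -/
def polyHarmonic (n : ℕ) (E : Type*) [NormedAddCommGroup E] [InnerProductSpace ℂ E]
    [CompleteSpace E] : Submodule ℂ (Op (HTensor E (Fock n))) where
  carrier := {T | ∃ p ∈ polysE n E, ∃ q ∈ polysE n E, T = star p + q}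
  zero_mem' := ⟨0, Submodule.zero_mem _, 0, Submodule.zero_mem _, by simp⟩
  add_mem' := by
    rintro _ _ ⟨p, hp, q, hq, rfl⟩ ⟨p', hp', q', hq', rfl⟩
    exact ⟨p + p', add_mem hp hp', q + q', add_mem hq hq', by rw [star_add]; abel⟩
  smul_mem' := by
    rintro c _ ⟨p, hp, q, hq, rfl⟩
    exact ⟨star c • p, Submodule.smul_mem _ _ hp, c • q, Submodule.smul_mem _ _ hq, by
      rw [star_smul, star_star, smul_add]⟩

theorem harmonicSpace_add [CompleteSpace E] {f g : Op (HTensor E (Fock n))} (hf : f ∈ harmonicSpace n E)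
    (hg : g ∈ harmonicSpace n E) : f + g ∈ harmonicSpace n E :=
  (polyHarmonic n E).topologicalClosure.add_mem hf hg

theorem harmonicSpace_smul [CompleteSpace E] (c : ℂ) {f : Op (HTensor E (Fock n))} (hf : f ∈ harmonicSpace n E) :
    c • f ∈ harmonicSpace n E :=
  (polyHarmonic n E).topologicalClosure.smul_mem c hf

theorem harmonicSpace_star {f : Op (HTensor E (Fock n))} (hf : f ∈ harmonicSpace n E) :
    star f ∈ harmonicSpace n E := by
  refine map_mem_closure continuous_star hf ?_
  rintro _ ⟨p, hp, q, hq, rfl⟩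
  exact ⟨q, hq, p, hp, by rw [star_add, star_star, add_comm]⟩

theorem harmonicSpace_rePart [CompleteSpace E] {f : Op (HTensor E (Fock n))} (hf : f ∈ harmonicSpace n E) :
    rePart f ∈ harmonicSpace n E :=
  harmonicSpace_smul _ (harmonicSpace_add hf (harmonicSpace_star hf))

/-- The density principle behind all identities for the Poisson transform: a closed, linear and
adjoint-stable property needs checking on monomials only. -/
theorem harmonicSpace_induction {p : Op (HTensor E (Fock n)) → Prop} (hc : IsClosed {f | p f})
    (hadd : ∀ f g, p f → p g → p (f + g)) (hsmul : ∀ (c : ℂ) f, p f → p (c • f))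
    (hstar : ∀ f, p f → p (star f)) (hgen : ∀ Y α, p (opTensor Y (wordProd leftCreation α)))
    {f : Op (HTensor E (Fock n))} (hf : f ∈ harmonicSpace n E) : p f := by
  refine closure_minimal (t := {f | p f}) ?_ hc hf
  rintro _ ⟨q, hq, r, hr, rfl⟩
  exact hadd _ _ (hstar _ (polysE_induction hadd hsmul hgen hq))
    (polysE_induction hadd hsmul hgen hr)

theorem polysE_subset_harmonicSpace {f : Op (HTensor E (Fock n))} (hf : f ∈ polysE n E) :
    f ∈ harmonicSpace n E :=
  subset_closure ⟨0, Submodule.zero_mem _, f, hf, by simp⟩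

theorem homogPart_zero {H : Type*} [NormedAddCommGroup H] [InnerProductSpace ℂ H]
    (A : FreeMonoid (Fin n) → Op E) (X : Fin n → Op H) :
    homogPart A X 0 = opTensor (A 1) 1 := by
  have : ∀ w : Fin 0 → Fin n, word w = 1 := fun w => by simp [word]
  simp [homogPart, this, wordProd_one]

theorem homogPart_eq_zero {H : Type*} [NormedAddCommGroup H] [InnerProductSpace ℂ H]
    {A : FreeMonoid (Fin n) → Op E} (hA : ∀ α, A α = 0)
    (X : Fin n → Op H) (k : ℕ) : homogPart A X k = 0 := by
  simp only [homogPart, hA, opTensor_zero_left, Finset.sum_const_zero]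

open Classical in
/-- The coefficients with the constant one removed. -/
def dropConstant (A : FreeMonoid (Fin n) → Op E) (α : FreeMonoid (Fin n)) : Op E :=
  if α = 1 then 0 else A α

theorem homogPart_dropConstant {H : Type*} [NormedAddCommGroup H]
    [InnerProductSpace ℂ H] (A : FreeMonoid (Fin n) → Op E) (X : Fin n → Op H) (k : ℕ) :
    homogPart (dropConstant A) X k = homogPart A X k - if k = 0 then homogPart A X 0 else 0 := by
  split_ifs with h
  · subst h
    rw [sub_self, homogPart_zero, dropConstant, if_pos rfl, opTensor_zero_left]
  · rw [sub_zero]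
    refine Finset.sum_congr rfl fun w _ => ?_
    rw [dropConstant, if_neg]
    intro h'
    exact h (by rw [← length_word w, h', FreeMonoid.length_one])

end HarmonicSpace

/-! ### Fourier coefficients and the Fourier form of the Poisson transform -/

section Coefficients

variable {n : ℕ} {E : Type*} [NormedAddCommGroup E] [InnerProductSpace ℂ E] [CompleteSpace E]

/-- The Fourier coefficient of `f` at the word `α`, with
`⟪y, coef f α x⟫ = ⟪y ⊗ e_α, f (x ⊗ 1)⟫`. -/
def coef (f : Op (HTensor E (Fock n))) (α : FreeMonoid (Fin n)) : Op E :=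
  (tmulRight E (fockBasis α)).adjoint ∘L f ∘L tmulRight E (fockBasis 1)

theorem inner_coef (f : Op (HTensor E (Fock n))) (α : FreeMonoid (Fin n)) (x y : E) :
    ⟪y, coef f α x⟫_ℂ = ⟪tmul y (fockBasis α), f (tmul x (fockBasis 1))⟫_ℂ := by
  rw [coef, ContinuousLinearMap.comp_apply, ContinuousLinearMap.adjoint_inner_right]
  rfl

theorem coef_add (f g : Op (HTensor E (Fock n))) : coef (f + g) = coef f + coef g := by
  funext α
  simp only [coef, ContinuousLinearMap.add_comp, ContinuousLinearMap.comp_add, Pi.add_apply]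

theorem coef_smul (c : ℂ) (f : Op (HTensor E (Fock n))) : coef (c • f) = c • coef f := by
  funext α
  simp only [coef, ContinuousLinearMap.smul_comp, ContinuousLinearMap.comp_smul, Pi.smul_apply]

theorem continuous_coef (α : FreeMonoid (Fin n)) :
    Continuous fun f : Op (HTensor E (Fock n)) => coef f α :=
  continuous_const.clm_comp (continuous_id.clm_comp continuous_const)

theorem coef_opTensor (Y : Op E) (T : Op (Fock n)) (α : FreeMonoid (Fin n)) :
    coef (opTensor Y T) α = ⟪fockBasis α, T (fockBasis 1)⟫_ℂ • Y := by
  ext x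
  refine ext_inner_left ℂ fun y => ?_
  rw [inner_coef, opTensor_tmul, inner_tmul, smul_apply, inner_smul_right,
    mul_comm]

theorem coef_star_one (f : Op (HTensor E (Fock n))) : coef (star f) 1 = star (coef f 1) := by
  ext x
  refine ext_inner_left ℂ fun y => ?_
  rw [inner_coef, ContinuousLinearMap.star_eq_adjoint, ContinuousLinearMap.star_eq_adjoint,
    ContinuousLinearMap.adjoint_inner_right, ContinuousLinearMap.adjoint_inner_right,
    ← inner_conj_symm, ← inner_coef, inner_conj_symm]

theorem wordProd_leftCreation_fockBasis (α β : FreeMonoid (Fin n)) :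
    wordProd leftCreation α (fockBasis β) = fockBasis (α * β) := by
  refine FreeMonoid.recOn α ?_ fun i γ ih => ?_
  · rw [wordProd_one, one_mul, one_apply_eq_self]
  · rw [wordProd_of_mul, mul_apply_eq_comp, ih, leftCreation_fockBasis, mul_assoc]

open Classical in
theorem coef_opTensor_wordProd (Y : Op E) (α β : FreeMonoid (Fin n)) :
    coef (opTensor Y (wordProd leftCreation α)) β = if β = α then Y else 0 := by
  rw [coef_opTensor, wordProd_leftCreation_fockBasis, mul_one, inner_fockBasis]
  split_ifs <;> simp

/-- S_α^* kills the vacuum when α ≠ 1, so coefficients see only the analytic part of f; the rest is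
read off from f^*. -/
theorem coef_star_opTensor_wordProd (Y : Op E) {α : FreeMonoid (Fin n)} (hα : α ≠ 1)
    (β : FreeMonoid (Fin n)) :
    coef (star (opTensor Y (wordProd leftCreation α))) β = 0 := by
  rw [opTensor_star, coef_opTensor, ContinuousLinearMap.star_eq_adjoint (wordProd _ _),
    ContinuousLinearMap.adjoint_inner_right, wordProd_leftCreation_fockBasis, inner_fockBasis,
    if_neg, zero_smul]
  exact fun h => hα (List.append_eq_nil_iff.mp h).1

theorem homogPart_coef_opTensor_wordProd {H : Type*} [NormedAddCommGroup H]
    [InnerProductSpace ℂ H] (Y : Op E) {m : ℕ} (v : Fin m → Fin n)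
    (X : Fin n → Op H) (k : ℕ) :
    homogPart (coef (opTensor Y (wordProd leftCreation (word v)))) X k =
      if k = m then opTensor Y (wordProd X (word v)) else 0 := by
  classical
  simp only [homogPart, coef_opTensor_wordProd]
  split_ifs with h
  · subst h
    rw [Finset.sum_eq_single v]
    · rw [if_pos rfl]
    · intro w _ hw
      rw [if_neg (fun h => hw (word_injective h)), opTensor_zero_left]
    · simp
  · refine Finset.sum_eq_zero fun w _ => ?_
    rw [if_neg, opTensor_zero_left]
    intro h'
    exact h (by rw [← length_word w, h', length_word])

/-- Bessel's inequality for z = f(x ⊗ 1): y is the projection of z onto the span of the E ⊗ e_{g i},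
so ⟪y, z⟫ = ‖y‖² and ‖y‖ ≤ ‖z‖ ≤ ‖f‖ ‖x‖. -/
theorem sum_norm_sq_coef_le {ι : Type*} [Fintype ι] {g : ι → FreeMonoid (Fin n)}
    (hg : Function.Injective g) (f : Op (HTensor E (Fock n))) (x : E) :
    ∑ i, ‖coef f (g i) x‖ ^ 2 ≤ ‖f‖ ^ 2 * ‖x‖ ^ 2 := by
  classical
  set z := f (tmul x (fockBasis 1))
  set y := ∑ i, tmul (coef f (g i) x) (fockBasis (g i))
  have hyz : ⟪y, z⟫_ℂ = ((∑ i, ‖coef f (g i) x‖ ^ 2 : ℝ) : ℂ) := by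
    rw [sum_inner]
    push_cast
    refine Finset.sum_congr rfl fun i _ => ?_
    rw [← inner_coef, inner_self_eq_norm_sq_to_K]
    rfl
  have hyy : ⟪y, y⟫_ℂ = ((∑ i, ‖coef f (g i) x‖ ^ 2 : ℝ) : ℂ) := by
    rw [sum_inner]
    push_cast
    refine Finset.sum_congr rfl fun i _ => ?_
    rw [inner_sum, Finset.sum_eq_single i]
    · rw [inner_tmul, inner_fockBasis, if_pos rfl, mul_one, inner_self_eq_norm_sq_to_K]
      rfl
    · intro j _ hj
      rw [inner_tmul, inner_fockBasis, if_neg (fun h => hj (hg h).symm), mul_zero]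
    · simp
  have hy : ∑ i, ‖coef f (g i) x‖ ^ 2 = ‖y‖ ^ 2 := by
    rw [inner_self_eq_norm_sq_to_K] at hyy
    rw [← Complex.ofReal_inj, ← hyy]
    push_cast
    rfl
  have hle : ‖y‖ ^ 2 ≤ ‖y‖ * ‖z‖ := by
    rw [hy] at hyz
    refine le_trans (le_of_eq ?_) (norm_inner_le_norm (𝕜 := ℂ) y z)
    rw [hyz, Complex.norm_real, Real.norm_eq_abs, abs_of_nonneg (sq_nonneg _)]
  have hz : ‖z‖ ≤ ‖f‖ * ‖x‖ := by
    refine (f.le_opNorm _).trans (le_of_eq ?_)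
    rw [norm_tmul, (orthonormal_fockBasis n).1, mul_one]
  have hyz' : ‖y‖ ≤ ‖z‖ := by
    by_contra! h
    nlinarith [norm_nonneg z]
  rw [hy, ← mul_pow]
  exact pow_le_pow_left₀ (norm_nonneg _) (hyz'.trans hz) 2

variable {H : Type*} [NormedAddCommGroup H] [InnerProductSpace ℂ H] [CompleteSpace H]

theorem norm_homogPart_coef_le {X : Fin n → Op H} {ρ : ℝ} (hρ : 0 ≤ ρ)
    (hX : ‖∑ i, X i * star (X i)‖ ≤ ρ ^ 2) (f : Op (HTensor E (Fock n))) (k : ℕ) :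
    ‖homogPart (coef f) X k‖ ≤ ρ ^ k * ‖f‖ :=
  norm_sum_opTensor_le (norm_nonneg f) (by positivity)
    (norm_sum_star_mul_self_le (norm_nonneg f) (sum_norm_sq_coef_le word_injective f))
    (norm_sum_wordProd_le hρ hX k)

/-- The homogeneous part of degree `k` of the Fourier series of `f`, evaluated at `X`. -/
def homogCLM (E : Type*) [NormedAddCommGroup E] [InnerProductSpace ℂ E] [CompleteSpace E]
    (X : Fin n → Op H) (k : ℕ) : Op (HTensor E (Fock n)) →L[ℂ] Op (HTensor E H) :=
  LinearMap.mkContinuous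
    { toFun := fun f => homogPart (coef f) X k
      map_add' := fun f g => by rw [coef_add, homogPart_add]
      map_smul' := fun c f => by rw [coef_smul, homogPart_smul, RingHom.id_apply] }
    (Real.sqrt ‖∑ i, X i * star (X i)‖ ^ k) fun f =>
      norm_homogPart_coef_le (Real.sqrt_nonneg _) (Real.sq_sqrt (norm_nonneg _)).ge f k

theorem homogCLM_apply (X : Fin n → Op H) (k : ℕ) (f : Op (HTensor E (Fock n))) :
    homogCLM E X k f = homogPart (coef f) X k := rfl

/-- Summing in operator norm makes the analytic part continuous in f, as the density argument
requires. -/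
theorem summable_homogCLM {X : Fin n → Op H} (hX : X ∈ ncBall H n 1) :
    Summable (homogCLM E X) :=
  Summable.of_norm_bounded (summable_geometric_of_lt_one (Real.sqrt_nonneg _) hX) fun k =>
    LinearMap.mkContinuous_norm_le _ (by positivity) _

/-- The analytic part `∑_α coef f α ⊗ X_α` of the Fourier series of `f`. -/
def analyticCLM (E : Type*) [NormedAddCommGroup E] [InnerProductSpace ℂ E] [CompleteSpace E]
    (X : Fin n → Op H) : Op (HTensor E (Fock n)) →L[ℂ] Op (HTensor E H) :=
  ∑' k, homogCLM E X k

theorem hasSum_analyticCLM {X : Fin n → Op H} (hX : X ∈ ncBall H n 1)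
    (f : Op (HTensor E (Fock n))) :
    HasSum (homogPart (coef f) X) (analyticCLM E X f) :=
  (summable_homogCLM hX).hasSum.mapL
    (ContinuousLinearMap.apply ℂ (Op (HTensor E H)) f)

theorem analyticCLM_opTensor_wordProd {X : Fin n → Op H} (hX : X ∈ ncBall H n 1) (Y : Op E)
    (α : FreeMonoid (Fin n)) :
    analyticCLM E X (opTensor Y (wordProd leftCreation α)) = opTensor Y (wordProd X α) := by
  obtain ⟨m, v, rfl⟩ := exists_eq_word α
  refine (hasSum_analyticCLM hX _).unique ?_
  have : homogPart (coef (opTensor Y (wordProd leftCreation (word v)))) X = fun k =>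
      if k = m then opTensor Y (wordProd X (word v)) else 0 :=
    funext fun k => homogPart_coef_opTensor_wordProd Y v X k
  rw [this]
  exact hasSum_ite_eq m _

theorem homogCLM_zero_star (X : Fin n → Op H) (f : Op (HTensor E (Fock n))) :
    homogCLM E X 0 (star f) = star (homogCLM E X 0 f) := by
  rw [homogCLM_apply, homogCLM_apply, homogPart_zero, homogPart_zero, coef_star_one,
    opTensor_star, star_one]

theorem star_analyticCLM_star_opTensor_wordProd {X : Fin n → Op H} (hX : X ∈ ncBall H n 1)
    (Y : Op E) (α : FreeMonoid (Fin n)) :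
    star (analyticCLM E X (star (opTensor Y (wordProd leftCreation α)))) =
      homogCLM E X 0 (opTensor Y (wordProd leftCreation α)) := by
  rw [homogCLM_apply, homogPart_zero]
  by_cases hα : α = 1
  · subst hα
    have h : star (opTensor Y (wordProd leftCreation (1 : FreeMonoid (Fin n)))) =
        opTensor (star Y) (wordProd leftCreation (1 : FreeMonoid (Fin n))) := by
      rw [wordProd_one, opTensor_star, star_one]
    rw [h, analyticCLM_opTensor_wordProd hX, coef_opTensor_wordProd, if_pos rfl, opTensor_star,
      star_star, wordProd_one, star_one]
  · rw [coef_opTensor_wordProd, if_neg (Ne.symm hα), opTensor_zero_left]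
    have := hasSum_analyticCLM hX (star (opTensor Y (wordProd leftCreation α)))
    have h0 : homogPart (coef (star (opTensor Y (wordProd leftCreation α)))) X = fun _ => 0 :=
      funext fun k => homogPart_eq_zero (coef_star_opTensor_wordProd Y hα) X k
    rw [h0] at this
    rw [this.unique hasSum_zero, star_zero]

set_option maxHeartbeats 800000 in
-- The subtracted term corrects for the constant coefficient, which both f and f^* contribute. Both
-- sides are continuous and compatible with sums, scalars and adjoints, so monomials suffice.
theorem poisson_eq_analyticCLM {X : Fin n → Op H} (hX : X ∈ ncBall H n 1)
    {f : Op (HTensor E (Fock n))} (hf : f ∈ harmonicSpace n E) :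
    poisson X f = analyticCLM E X f + star (analyticCLM E X (star f)) - homogCLM E X 0 f := by
  rw [← poissonCLM_apply X f]
  -- The three maps are made opaque: only continuity, linearity, behaviour under adjoints and values
  -- on monomials enter.
  generalize hP : poissonCLM E X = P
  have hPstar (f) : P (star f) = star (P f) := by
    rw [← hP]
    exact poisson_star X f
  have hPgen (Y : Op E) (α) : P (opTensor Y (wordProd leftCreation α)) =
      opTensor Y (wordProd X α) := by
    rw [← hP]
    exact poisson_opTensor_wordProd hX Y α
  have hLgen := analyticCLM_opTensor_wordProd (E := E) hX
  have hLstar := star_analyticCLM_star_opTensor_wordProd (E := E) hX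
  have hQstar := homogCLM_zero_star (E := E) X
  generalize analyticCLM E X = L at hLgen hLstar ⊢
  generalize homogCLM E X 0 = Q at hLstar hQstar ⊢
  refine harmonicSpace_induction (p := fun f => P f = L f + star (L (star f)) - Q f)
    (isClosed_eq P.continuous (((L.continuous).add
      (L.continuous.comp continuous_star).star).sub Q.continuous)) ?_ ?_ ?_ ?_ hf
  · intro f g hf hg
    rw [map_add, hf, hg, map_add, star_add, map_add, map_add, star_add]
    abel
  · intro c f hf
    rw [map_smul, hf, map_smul, star_smul, map_smul, map_smul, star_smul, star_star, smul_sub,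
      smul_add]
  · intro f hf
    rw [hPstar, hf, hQstar, star_star, star_sub, star_add, star_star, add_comm (star (L f))]
  · intro Y α
    rw [hPgen, hLgen, hLstar, add_sub_cancel_right]

theorem poisson_eq_tsum {X : Fin n → Op H} (hX : X ∈ ncBall H n 1)
    {f : Op (HTensor E (Fock n))} (hf : f ∈ harmonicSpace n E) :
    poisson X f = ∑' k, homogPart (coef f) X k +
      star (∑' k, homogPart (dropConstant (coef (star f))) X k) := by
  have h : HasSum (homogPart (dropConstant (coef (star f))) X)
      (analyticCLM E X (star f) - homogPart (coef (star f)) X 0) := by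
    refine ((hasSum_analyticCLM hX (star f)).sub (hasSum_ite_eq 0 _)).congr_fun ?_
    exact fun k => homogPart_dropConstant _ X k
  rw [h.tsum_eq, (hasSum_analyticCLM hX f).tsum_eq, poisson_eq_analyticCLM hX hf, homogCLM_apply,
    homogPart_zero, homogPart_zero, coef_star_one, star_sub, opTensor_star, star_star, star_one]
  abel

end Coefficients

/-! ### Dilations and the points rS -/

section Dilation

variable {n : ℕ} {E : Type*} {H : Type*}
  [NormedAddCommGroup E] [InnerProductSpace ℂ E] [CompleteSpace E]
  [NormedAddCommGroup H] [InnerProductSpace ℂ H] [CompleteSpace H]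

theorem sqrt_norm_sum_smul (c : ℂ) (X : Fin n → Op H) :
    Real.sqrt ‖∑ i, (c • X) i * star ((c • X) i)‖ =
      ‖c‖ * Real.sqrt ‖∑ i, X i * star (X i)‖ := by
  have : ∑ i, (c • X) i * star ((c • X) i) = (c * star c) • ∑ i, X i * star (X i) := by
    rw [Finset.smul_sum]
    refine Finset.sum_congr rfl fun i _ => ?_
    rw [Pi.smul_apply, star_smul, smul_mul_smul_comm]
  rw [this, norm_smul, norm_mul, norm_star, Real.sqrt_mul (by positivity),
    Real.sqrt_mul_self (norm_nonneg c)]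

theorem smul_mem_ncBall {X : Fin n → Op H} {γ : ℝ} (hX : X ∈ ncBall H n γ) {c : ℝ} (hc : 0 < c) :
    (c : ℂ) • X ∈ ncBall H n (c * γ) := by
  change Real.sqrt _ < _
  rw [sqrt_norm_sum_smul, Complex.norm_real, Real.norm_eq_abs, abs_of_pos hc]
  exact mul_lt_mul_of_pos_left hX hc

theorem inv_smul_mem_ncBall {X : Fin n → Op H} {r : ℝ} (hX : X ∈ ncBall H n r) (hr : 0 < r) :
    ((1 / r : ℝ) : ℂ) • X ∈ ncBall H n 1 := by
  have := smul_mem_ncBall hX (c := 1 / r) (by positivity)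
  rwa [one_div_mul_cancel hr.ne'] at this

/-- The S_i are isometries with orthogonal ranges, so the sum is a projection. -/
theorem norm_sum_leftCreation_le : ‖∑ i, leftCreation (n := n) i * star (leftCreation i)‖ ≤ 1 := by
  set p := ∑ i, leftCreation (n := n) i * star (leftCreation i) with hp
  have h : star p * p = p := by
    simp only [hp, star_sum, star_mul, star_star, Finset.sum_mul_sum]
    refine Finset.sum_congr rfl fun i _ => ?_
    rw [Finset.sum_eq_single i]
    · rw [mul_assoc, ← mul_assoc (star _), star_leftCreation_mul, if_pos rfl, one_mul]
    · intro j _ hj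
      rw [mul_assoc, ← mul_assoc (star _), star_leftCreation_mul, if_neg hj.symm, zero_mul,
        mul_zero]
    · simp
  have h' := CStarRing.norm_star_mul_self (x := p)
  rw [h] at h'
  by_contra! hlt
  nlinarith

theorem smul_leftCreation_mem_ncBall {r t : ℝ} (hr : 0 ≤ r) (hrt : r < t) :
    (r : ℂ) • leftCreation ∈ ncBall (Fock n) n t := by
  change Real.sqrt _ < _
  rw [sqrt_norm_sum_smul, Complex.norm_real, Real.norm_eq_abs, abs_of_nonneg hr]
  refine lt_of_le_of_lt (mul_le_of_le_one_right hr ?_) hrt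
  exact Real.sqrt_le_one.mpr norm_sum_leftCreation_le

theorem poisson_smul_leftCreation_opTensor {s : ℝ} (hs : 0 ≤ s) (hs1 : s < 1) (Y : Op E)
    (α : FreeMonoid (Fin n)) :
    poisson ((s : ℂ) • leftCreation) (opTensor Y (wordProd leftCreation α)) =
      (s : ℂ) ^ α.length • opTensor Y (wordProd leftCreation α) := by
  rw [poisson_opTensor_wordProd (smul_leftCreation_mem_ncBall hs hs1), wordProd_smul,
    opTensor_smul_right]

theorem coef_poisson {s : ℝ} (hs : 0 ≤ s) (hs1 : s < 1) {f : Op (HTensor E (Fock n))}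
    (hf : f ∈ harmonicSpace n E) (α : FreeMonoid (Fin n)) :
    coef (poisson ((s : ℂ) • leftCreation) f) α = (s : ℂ) ^ α.length • coef f α := by
  classical
  set P := poissonCLM E ((s : ℂ) • leftCreation (n := n)) with hP
  have hc := continuous_coef (E := E) α
  have hs' : Continuous fun f : Op (HTensor E (Fock n)) => (s : ℂ) ^ α.length • coef f α :=
    (continuous_const_smul _).comp hc
  -- Coefficients are not symmetric under adjoints, so the claim is carried for f and f^* together,
  -- and the adjoint step swaps the two.
  refine (harmonicSpace_induction (p := fun f => coef (P f) α = (s : ℂ) ^ α.length • coef f α ∧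
    coef (P (star f)) α = (s : ℂ) ^ α.length • coef (star f) α)
    (IsClosed.and (isClosed_eq (hc.comp P.continuous) hs')
      (isClosed_eq (hc.comp (P.continuous.comp continuous_star)) (hs'.comp continuous_star))) ?_ ?_ ?_ ?_ hf).1
  · intro f g hf hg
    simp only [star_add, map_add, coef_add, Pi.add_apply, smul_add]
    rw [hf.1, hf.2, hg.1, hg.2]
    exact ⟨rfl, rfl⟩
  · intro c f hf
    simp only [star_smul, map_smul, coef_smul, Pi.smul_apply]
    rw [hf.1, hf.2, smul_comm, smul_comm (star c)]
    exact ⟨rfl, rfl⟩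
  · intro f hf
    rw [star_star]
    exact ⟨hf.2, hf.1⟩
  · intro Y β
    have h1 := poisson_smul_leftCreation_opTensor (n := n) hs hs1 Y β
    constructor
    · rw [hP, poissonCLM_apply, h1, coef_smul, Pi.smul_apply, coef_opTensor_wordProd]
      split_ifs with h
      · rw [h]
      · rw [smul_zero, smul_zero]
    -- For β ≠ 1 all coefficients of the adjoint vanish; for β = 1 it is the constant Y^* ⊗ I, which
    -- the dilation fixes.
    · by_cases hβ : β = 1
      · subst hβ
        rw [hP, poissonCLM_apply, poisson_star, h1, FreeMonoid.length_one, pow_zero, one_smul,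
          wordProd_one, opTensor_star, star_one, coef_opTensor, one_apply_eq_self, inner_fockBasis]
        split_ifs with h
        · rw [h, FreeMonoid.length_one, pow_zero, one_smul, one_smul]
        · rw [zero_smul, smul_zero]
      · rw [hP, poissonCLM_apply, poisson_star, h1, star_smul, coef_smul, Pi.smul_apply,
          coef_star_opTensor_wordProd Y hβ, smul_zero, smul_zero]

end Dilation

/-! ### From power series to the Poisson formula -/

section PoissonOfExpansion

variable {n : ℕ} {E : Type*} {H : Type*}
  [NormedAddCommGroup E] [InnerProductSpace ℂ E] [CompleteSpace E]
  [NormedAddCommGroup H] [InnerProductSpace ℂ H] [CompleteSpace H]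
  {γ : ℝ} {A A₁ A₂ : FreeMonoid (Fin n) → Op E}

omit [CompleteSpace E] in
theorem homogPart_smul_leftCreation_mem (A : FreeMonoid (Fin n) → Op E) (c : ℂ) (k : ℕ) :
    homogPart A (c • leftCreation) k ∈ polysE n E := by
  rw [homogPart_smul_right]
  exact Submodule.smul_mem _ _ (Submodule.sum_mem _ fun _ _ => opTensor_wordProd_mem_polysE _ _)

theorem HasHolomorphicExpansion.mem_harmonicSpace
    {F : (Fin n → Op (Fock n)) → Op (HTensor E (Fock n))} (hF : HasHolomorphicExpansion γ A F)
    {r : ℝ} (hr : 0 ≤ r) (hrγ : r < γ) : F ((r : ℂ) • leftCreation) ∈ harmonicSpace n E :=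
  isClosed_closure.mem_of_tendsto (hF.tendsto _ (smul_leftCreation_mem_ncBall hr hrγ))
    (Eventually.of_forall fun _ => polysE_subset_harmonicSpace
      (Submodule.sum_mem _ fun k _ => homogPart_smul_leftCreation_mem A r k))

theorem smul_one_div_smul {V : Type*} [AddCommGroup V] [Module ℂ V] {r : ℝ} (hr : 0 < r) (x : V) :
    (r : ℂ) • ((1 / r : ℝ) : ℂ) • x = x := by
  rw [smul_smul, ← Complex.ofReal_mul, mul_one_div_cancel hr.ne', Complex.ofReal_one, one_smul]

theorem poisson_homogPart (A : FreeMonoid (Fin n) → Op E) {r : ℝ} (hr : 0 < r)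
    {X : Fin n → Op H} (hX : X ∈ ncBall H n r) (k : ℕ) :
    poisson (((1 / r : ℝ) : ℂ) • X) (homogPart A ((r : ℂ) • leftCreation) k) =
      homogPart A X k := by
  conv_rhs => rw [← smul_one_div_smul hr X, homogPart_smul_right]
  rw [homogPart_smul_right, ← poissonCLM_apply, map_smul, homogPart, map_sum]
  congr 1
  refine Finset.sum_congr rfl fun w _ => ?_
  rw [poissonCLM_apply, poisson_opTensor_wordProd (inv_smul_mem_ncBall hX hr)]

/-- The Poisson transform is continuous, so it passes through the series at rS, and each homogeneous
part goes to its value at X. -/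
theorem HasHolomorphicExpansion.poisson_eq {F : (Fin n → Op H) → Op (HTensor E H)}
    {F' : (Fin n → Op (Fock n)) → Op (HTensor E (Fock n))}
    (hF : HasHolomorphicExpansion γ A F) (hF' : HasHolomorphicExpansion γ A F')
    {r : ℝ} (hr : 0 < r) (hrγ : r < γ) {X : Fin n → Op H} (hX : X ∈ ncBall H n r) :
    poisson (((1 / r : ℝ) : ℂ) • X) (F' ((r : ℂ) • leftCreation)) = F X := by
  have h' := ((poissonCLM E (((1 / r : ℝ) : ℂ) • X)).continuous.tendsto _).comp
    (hF'.tendsto _ (smul_leftCreation_mem_ncBall hr.le hrγ))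
  refine tendsto_nhds_unique h' ?_
  convert hF.tendsto X (lt_trans hX hrγ) using 2 with m
  rw [Function.comp_apply, map_sum]
  exact Finset.sum_congr rfl fun k _ => poisson_homogPart A hr hX k

omit [CompleteSpace E] in
theorem poisson_rePart (X : Fin n → Op H) (f : Op (HTensor E (Fock n))) :
    poisson X (rePart f) = rePart (poisson X f) := by
  rw [rePart, ← poissonCLM_apply, map_smul, map_add, poissonCLM_apply, poissonCLM_apply,
    poisson_star, rePart]

theorem HasPluriharmonicExpansion.mem_harmonicSpace
    {w : (Fin n → Op (Fock n)) → Op (HTensor E (Fock n))}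
    (hw : HasPluriharmonicExpansion γ A₁ A₂ w) {r : ℝ} (hr : 0 ≤ r) (hrγ : r < γ) :
    w ((r : ℂ) • leftCreation) ∈ harmonicSpace n E := by
  obtain ⟨-, F₁, F₂, h₁, h₂, h⟩ := hw
  rw [h _ (smul_leftCreation_mem_ncBall hr hrγ)]
  exact harmonicSpace_add (harmonicSpace_rePart (h₁.mem_harmonicSpace hr hrγ))
    (harmonicSpace_smul _ (harmonicSpace_rePart (h₂.mem_harmonicSpace hr hrγ)))

theorem HasPluriharmonicExpansion.eq_poisson {u : (Fin n → Op H) → Op (HTensor E H)}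
    {w : (Fin n → Op (Fock n)) → Op (HTensor E (Fock n))}
    (hu : HasPluriharmonicExpansion γ A₁ A₂ u) (hw : HasPluriharmonicExpansion γ A₁ A₂ w)
    {r : ℝ} (hr : 0 < r) (hrγ : r < γ) {X : Fin n → Op H} (hX : X ∈ ncBall H n r) :
    u X = poisson (((1 / r : ℝ) : ℂ) • X) (w ((r : ℂ) • leftCreation)) := by
  obtain ⟨-, F₁, F₂, h₁, h₂, h⟩ := hu
  obtain ⟨-, G₁, G₂, h₁', h₂', h'⟩ := hw
  rw [h X (lt_trans hX hrγ), h' _ (smul_leftCreation_mem_ncBall hr.le hrγ), ← poissonCLM_apply,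
    map_add, map_smul, poissonCLM_apply, poissonCLM_apply, poisson_rePart, poisson_rePart,
    h₁.poisson_eq h₁' hr hrγ hX, h₂.poisson_eq h₂' hr hrγ hX]

theorem HasPluriharmonicExpansion.exists_representation {K : Type*} [NormedAddCommGroup K]
    [InnerProductSpace ℂ K] [CompleteSpace K] {u : (Fin n → Op H) → Op (HTensor E H)}
    (hu : HasPluriharmonicExpansion γ A₁ A₂ u) :
    ∃ w : (Fin n → Op K) → Op (HTensor E K), HasPluriharmonicExpansion γ A₁ A₂ w := by
  obtain ⟨-, F₁, F₂, h₁, h₂, -⟩ := hu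
  exact ⟨_, hasPluriharmonicExpansion_of_holomorphic (hasHolomorphicExpansion_tsum h₁.le_radius)
    (hasHolomorphicExpansion_tsum h₂.le_radius) fun _ _ => rfl⟩

end PoissonOfExpansion

/-! ### Coefficients of geometric growth -/

section GeometricGrowth

variable {n : ℕ} {E : Type*} [NormedAddCommGroup E] [InnerProductSpace ℂ E]

/-- For every `t < γ` the columns `(A_(α))_{|α| = k}` have norm `O(t⁻ᵏ)`. -/
def HasGeometricGrowth (γ : ℝ) (A : FreeMonoid (Fin n) → Op E) : Prop :=
  ∀ t : ℝ, 0 < t → t < γ → ∃ C : ℝ, 0 ≤ C ∧ ∀ (k : ℕ) (x : E),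
    ∑ w : Fin k → Fin n, ‖A (word w) x‖ ^ 2 ≤ (C * (1 / t) ^ k) ^ 2 * ‖x‖ ^ 2

variable {γ : ℝ} {A B : FreeMonoid (Fin n) → Op E}

theorem HasGeometricGrowth.le_radius [CompleteSpace E] (hA : HasGeometricGrowth γ A) :
    ENNReal.ofReal γ ≤ radius A := by
  refine le_radius_of_geometric_bound fun t ht htγ => ?_
  obtain ⟨C, hC, h⟩ := hA t ht htγ
  refine ⟨C ^ 2, fun k => ?_⟩
  rw [← mul_pow]
  exact norm_sum_star_mul_self_le (by positivity) (h k)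

theorem HasGeometricGrowth.mono (hA : HasGeometricGrowth γ A)
    (h : ∀ α x, ‖B α x‖ ≤ ‖A α x‖) : HasGeometricGrowth γ B := by
  intro t ht htγ
  obtain ⟨C, hC, hA⟩ := hA t ht htγ
  refine ⟨C, hC, fun k x => (Finset.sum_le_sum fun w _ => ?_).trans (hA k x)⟩
  exact pow_le_pow_left₀ (norm_nonneg _) (h _ x) 2

theorem HasGeometricGrowth.smul (hA : HasGeometricGrowth γ A) (c : ℂ) :
    HasGeometricGrowth γ (c • A) := by
  intro t ht htγ
  obtain ⟨C, hC, hA⟩ := hA t ht htγ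
  refine ⟨‖c‖ * C, by positivity, fun k x => ?_⟩
  simp only [Pi.smul_apply, smul_apply, norm_smul, mul_pow, ← Finset.mul_sum]
  grw [hA k x]
  exact le_of_eq (by ring)

theorem HasGeometricGrowth.add (hA : HasGeometricGrowth γ A) (hB : HasGeometricGrowth γ B) :
    HasGeometricGrowth γ (A + B) := by
  intro t ht htγ
  obtain ⟨C, hC, hA⟩ := hA t ht htγ
  obtain ⟨D, hD, hB⟩ := hB t ht htγ
  -- A generous constant: (p + q)² ≤ 2p² + 2q² and 2(C² + D²) ≤ (2(C + D))².
  refine ⟨2 * (C + D), by positivity, fun k x => ?_⟩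
  calc ∑ w : Fin k → Fin n, ‖(A + B) (word w) x‖ ^ 2
      ≤ ∑ w : Fin k → Fin n, (2 * ‖A (word w) x‖ ^ 2 + 2 * ‖B (word w) x‖ ^ 2) := by
        refine Finset.sum_le_sum fun w _ => ?_
        have := norm_add_le (A (word w) x) (B (word w) x)
        have h2 := pow_le_pow_left₀ (norm_nonneg _) this 2
        refine h2.trans ?_
        nlinarith [sq_nonneg (‖A (word w) x‖ - ‖B (word w) x‖)]
    _ ≤ 2 * ((C * (1 / t) ^ k) ^ 2 * ‖x‖ ^ 2) + 2 * ((D * (1 / t) ^ k) ^ 2 * ‖x‖ ^ 2) := by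
        rw [Finset.sum_add_distrib, ← Finset.mul_sum, ← Finset.mul_sum]
        gcongr
        · exact hA k x
        · exact hB k x
    _ = (2 * (C ^ 2 + D ^ 2)) * (((1 / t) ^ k) ^ 2 * ‖x‖ ^ 2) := by ring
    _ ≤ (2 * (C + D)) ^ 2 * (((1 / t) ^ k) ^ 2 * ‖x‖ ^ 2) := by
        refine mul_le_mul_of_nonneg_right ?_ (by positivity)
        nlinarith [mul_nonneg hC hD]
    _ = _ := by ring

end GeometricGrowth

/-! ### Families compatible under dilation -/

section RadialFamilies

variable {n : ℕ} {E : Type*} [NormedAddCommGroup E] [InnerProductSpace ℂ E] [CompleteSpace E]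
  {γ : ℝ} {φ : ℝ → Op (HTensor E (Fock n))} {a b : FreeMonoid (Fin n) → Op E}

/-- Compatibility and `coef_poisson` give coef (φ r) α = (r/t)^{|α|} coef (φ t) α, so coef (φ t) α /
t^{|α|} does not depend on t; a is its value at an arbitrary reference radius s. -/
theorem exists_coef_eq_smul (hγ : 0 < γ)
    (hφ : ∀ r : ℝ, 0 ≤ r → r < γ → φ r ∈ harmonicSpace n E)
    (hφ' : ∀ r t : ℝ, 0 ≤ r → r < t → t < γ →
      φ r = poisson (((r / t : ℝ) : ℂ) • leftCreation) (φ t)) :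
    ∃ a : FreeMonoid (Fin n) → Op E, ∀ t : ℝ, 0 < t → t < γ → ∀ α,
      coef (φ t) α = (t : ℂ) ^ α.length • a α := by
  have key : ∀ r t : ℝ, 0 < r → r < t → t < γ → ∀ α,
      (t : ℂ) ^ α.length • coef (φ r) α = (r : ℂ) ^ α.length • coef (φ t) α := by
    intro r t hr hrt htγ α
    have ht : 0 < t := hr.trans hrt
    have ht' : (t : ℂ) ≠ 0 := Complex.ofReal_ne_zero.mpr ht.ne'
    rw [hφ' r t hr.le hrt htγ, coef_poisson (by positivity) ((div_lt_one ht).mpr hrt)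
      (hφ t ht.le htγ), smul_smul, ← mul_pow, Complex.ofReal_div, mul_div_cancel₀ _ ht']
  obtain ⟨s, hs, hsγ⟩ := exists_between hγ
  have hs' : (s : ℂ) ≠ 0 := Complex.ofReal_ne_zero.mpr hs.ne'
  refine ⟨fun α => ((s : ℂ) ^ α.length)⁻¹ • coef (φ s) α, fun t ht htγ α => ?_⟩
  rw [smul_comm, eq_inv_smul_iff₀ (pow_ne_zero _ hs')]
  rcases lt_trichotomy t s with h | rfl | h
  · exact key t s ht h hsγ α
  · rfl
  · exact (key s t hs h htγ α).symm

/-- The Bessel bound for φ t, divided by t^{2k}, with constant ‖φ t‖. -/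
theorem hasGeometricGrowth_of_coef
    (ha : ∀ t : ℝ, 0 < t → t < γ → ∀ α, coef (φ t) α = (t : ℂ) ^ α.length • a α) :
    HasGeometricGrowth γ a := by
  intro t ht htγ
  refine ⟨‖φ t‖, norm_nonneg _, fun k x => ?_⟩
  have h := sum_norm_sq_coef_le word_injective (φ t) x (ι := Fin k → Fin n)
  simp only [ha t ht htγ, length_word, smul_apply, norm_smul, norm_pow, Complex.norm_real,
    Real.norm_eq_abs, abs_of_pos ht, mul_pow, ← Finset.mul_sum] at h
  rw [mul_pow, one_div, inv_pow, inv_pow, mul_right_comm, ← div_eq_mul_inv,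
    le_div_iff₀ (by positivity), mul_comm]
  exact h

omit [CompleteSpace E] in
theorem HasGeometricGrowth.dropConstant (ha : HasGeometricGrowth γ a) :
    HasGeometricGrowth γ (dropConstant a) := by
  refine ha.mono fun α x => ?_
  rw [FreePluri.dropConstant]
  split_ifs
  · simp
  · exact le_rfl

/-- The function `X ↦ ∑ a_(α) ⊗ X_α + (∑ b_(α) ⊗ X_α)^*`. -/
def pluriharmonicSum (H : Type*) [NormedAddCommGroup H] [InnerProductSpace ℂ H] [CompleteSpace H]
    (a b : FreeMonoid (Fin n) → Op E) (X : Fin n → Op H) : Op (HTensor E H) :=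
  ∑' k, homogPart a X k + star (∑' k, homogPart b X k)

variable {H : Type*} [NormedAddCommGroup H] [InnerProductSpace ℂ H] [CompleteSpace H]

omit [CompleteSpace E] [CompleteSpace H] in
-- As Re(-iW) = Im W, this is S + T^* = Re(S + T) + i Im(S - T).
theorem add_star_eq_rePart (S T : Op (HTensor E H)) :
    S + star T = rePart (S + T) + Complex.I • rePart ((-Complex.I) • (S + (-1 : ℂ) • T)) := by
  have h1 : star (-Complex.I) = Complex.I := by simp
  have h2 : star (-1 : ℂ) = -1 := by simp
  simp only [rePart, star_add, star_smul, h1, smul_add, smul_smul]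
  have h3 : Complex.I * (1 / 2 * -Complex.I) = 1 / 2 := by
    linear_combination (-1 / 2) * Complex.I_mul_I
  have h4 : Complex.I * (1 / 2 * (-Complex.I * -1)) = -1 / 2 := by
    linear_combination (1 / 2) * Complex.I_mul_I
  have h5 : Complex.I * (1 / 2 * Complex.I) = -1 / 2 := by
    linear_combination (1 / 2) * Complex.I_mul_I
  have h6 : Complex.I * (1 / 2 * star (-Complex.I * -1)) = 1 / 2 := by
    rw [star_mul, h1, h2]
    linear_combination (-1 / 2) * Complex.I_mul_I
  rw [h3, h4, h5, h6]
  module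

theorem hasPluriharmonicExpansion_pluriharmonicSum (ha : HasGeometricGrowth γ a)
    (hb : HasGeometricGrowth γ b) :
    HasPluriharmonicExpansion γ (a + b) ((-Complex.I) • (a + (-1 : ℂ) • b))
      (pluriharmonicSum H a b) := by
  have h₁ := (ha.add hb).le_radius
  have h₂ := ((ha.add (hb.smul (-1))).smul (-Complex.I)).le_radius
  refine hasPluriharmonicExpansion_of_holomorphic (hasHolomorphicExpansion_tsum h₁)
    (hasHolomorphicExpansion_tsum h₂) fun X hX => ?_
  have hSa := (summable_homogPart ha.le_radius hX).hasSum
  have hSb := (summable_homogPart hb.le_radius hX).hasSum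
  have e₁ : ∑' k, homogPart (a + b) X k = ∑' k, homogPart a X k + ∑' k, homogPart b X k := by
    simp only [homogPart_add]
    exact (hSa.add hSb).tsum_eq
  have e₂ : ∑' k, homogPart ((-Complex.I) • (a + (-1 : ℂ) • b)) X k =
      (-Complex.I) • (∑' k, homogPart a X k + (-1 : ℂ) • ∑' k, homogPart b X k) := by
    simp only [homogPart_add, homogPart_smul]
    exact ((hSa.add (hSb.const_smul (-1))).const_smul (-Complex.I)).tsum_eq
  rw [e₁, e₂]
  exact add_star_eq_rePart _ _

omit [CompleteSpace H] in
theorem homogPart_coef_smul {t : ℝ} (ht : 0 < t) {f : Op (HTensor E (Fock n))}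
    (hf : ∀ α, coef f α = (t : ℂ) ^ α.length • a α) (X : Fin n → Op H) (k : ℕ) :
    homogPart (coef f) (((1 / t : ℝ) : ℂ) • X) k = homogPart a X k := by
  conv_rhs => rw [← smul_one_div_smul ht X, homogPart_smul_right]
  simp only [homogPart, hf, length_word, opTensor_smul_left, Finset.smul_sum]

/-- The left side does not involve t: this is the independence of the radius in the definition of v.
-/
theorem pluriharmonicSum_eq_poisson {t : ℝ} (ht : 0 < t) {f : Op (HTensor E (Fock n))}
    (hf : f ∈ harmonicSpace n E) (ha : ∀ α, coef f α = (t : ℂ) ^ α.length • a α)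
    (hb : ∀ α, coef (star f) α = (t : ℂ) ^ α.length • b α) {X : Fin n → Op H}
    (hX : X ∈ ncBall H n t) :
    pluriharmonicSum H a (dropConstant b) X = poisson (((1 / t : ℝ) : ℂ) • X) f := by
  rw [poisson_eq_tsum (inv_smul_mem_ncBall hX ht) hf, pluriharmonicSum]
  simp only [homogPart_dropConstant, homogPart_coef_smul ht ha, homogPart_coef_smul ht hb]

end RadialFamilies

end FreePluri

end

/-! ### The theorem -/

open FreePluri in
theorem theorem2p5 {n : ℕ} (hn : 1 ≤ n) {γ : ℝ} (hγ : 0 < γ)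
    {E : Type*} [NormedAddCommGroup E] [InnerProductSpace ℂ E] [CompleteSpace E]
    {H : Type*} [NormedAddCommGroup H] [InnerProductSpace ℂ H] [CompleteSpace H] :
    (∀ u : (Fin n → Op H) → Op (HTensor E H), IsFreePluriharmonic γ u →
      (∃ w : (Fin n → Op (Fock n)) → Op (HTensor E (Fock n)), SameFreePluriharmonic γ u w) ∧
      ∀ w : (Fin n → Op (Fock n)) → Op (HTensor E (Fock n)), SameFreePluriharmonic γ u w →
        (∀ r : ℝ, 0 ≤ r → r < γ → w ((r : ℂ) • leftCreation) ∈ harmonicSpace n E) ∧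
        (∀ r : ℝ, 0 < r → r < γ → ∀ X ∈ ncBall H n r,
          u X = poisson (((1 / r : ℝ) : ℂ) • X) (w ((r : ℂ) • leftCreation)))) ∧
    (∀ φ : ℝ → Op (HTensor E (Fock n)),
      (∀ r : ℝ, 0 ≤ r → r < γ → φ r ∈ harmonicSpace n E) →
      (∀ r t : ℝ, 0 ≤ r → r < t → t < γ →
        φ r = poisson (((r / t : ℝ) : ℂ) • leftCreation) (φ t)) →
      ∃ (v : (Fin n → Op H) → Op (HTensor E H))
        (w : (Fin n → Op (Fock n)) → Op (HTensor E (Fock n))),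
        (∀ r : ℝ, 0 < r → r < γ → ∀ X ∈ ncBall H n r,
          v X = poisson (((1 / r : ℝ) : ℂ) • X) (φ r)) ∧
        (∀ r : ℝ, 0 < r → r < γ → ∀ Y ∈ ncBall (Fock n) n r,
          w Y = poisson (((1 / r : ℝ) : ℂ) • Y) (φ r)) ∧
        IsFreePluriharmonic γ v ∧ SameFreePluriharmonic γ v w ∧
        ∀ r : ℝ, 0 ≤ r → r < γ → w ((r : ℂ) • leftCreation) = φ r) := by
  constructor
  · intro u hu
    refine ⟨?_, ?_⟩
    · obtain ⟨A₁, A₂, hu⟩ := hu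
      obtain ⟨w, hw⟩ := hu.exists_representation (K := Fock n)
      exact ⟨w, A₁, A₂, hu, hw⟩
    · rintro w ⟨A₁, A₂, hu, hw⟩
      exact ⟨fun r hr hrγ => hw.mem_harmonicSpace hr hrγ,
        fun r hr hrγ X hX => hu.eq_poisson hw hr hrγ hX⟩
  · intro φ hφ hφ'
    obtain ⟨a, ha⟩ := exists_coef_eq_smul hγ hφ hφ'
    -- The adjoint family r ↦ φ(r)^* satisfies the same hypotheses, since the Poisson transform
    -- commutes with adjoints; its coefficients give the coanalytic part.
    obtain ⟨b, hb⟩ := exists_coef_eq_smul (φ := fun r => star (φ r)) hγ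
      (fun r hr hrγ => harmonicSpace_star (hφ r hr hrγ))
      (fun r t hr hrt htγ => by rw [poisson_star, ← hφ' r t hr hrt htγ])
    have hv := hasPluriharmonicExpansion_pluriharmonicSum (H := H)
      (hasGeometricGrowth_of_coef ha) (hasGeometricGrowth_of_coef hb).dropConstant
    have hw := hasPluriharmonicExpansion_pluriharmonicSum (H := Fock n)
      (hasGeometricGrowth_of_coef ha) (hasGeometricGrowth_of_coef hb).dropConstant
    have hpoisson : ∀ r : ℝ, 0 < r → r < γ → ∀ Y ∈ ncBall (Fock n) n r,
        pluriharmonicSum (Fock n) a (dropConstant b) Y =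
          poisson (((1 / r : ℝ) : ℂ) • Y) (φ r) := fun r hr hrγ Y hY =>
      pluriharmonicSum_eq_poisson hr (hφ r hr.le hrγ) (ha r hr hrγ) (hb r hr hrγ) hY
    refine ⟨pluriharmonicSum H a (dropConstant b), pluriharmonicSum (Fock n) a (dropConstant b),
      fun r hr hrγ X hX => pluriharmonicSum_eq_poisson hr (hφ r hr.le hrγ) (ha r hr hrγ)
        (hb r hr hrγ) hX, hpoisson, ⟨_, _, hv⟩, ⟨_, _, hv, hw⟩, fun r hr hrγ => ?_⟩
    -- The Poisson formula of radius r needs a point of the open r-ball, so a larger t is used: rS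
    -- lies in the t-ball, and compatibility returns from φ t to φ r. This includes r = 0.
    obtain ⟨t, hrt, htγ⟩ := exists_between hrγ
    rw [hpoisson t (hr.trans_lt hrt) htγ _ (smul_leftCreation_mem_ncBall hr hrt),
      hφ' r t hr hrt htγ, smul_smul, ← Complex.ofReal_mul, one_div_mul_eq_div]
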